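/- Let $G=(V,E)$ be a finite simple graph with edge weights $w_{ij}\ge 0$, with one qubit at each vertex. Let $H=\sum_{ij\in E} w_{ij}\,\tfrac12(\mathbb I-\mathrm{SWAP}_{ij})$ be the Quantum Max Cut Hamiltonian (as a maximization problem), where $\mathrm{SWAP}_{ij}$ exchanges qubits $i$ and $j$, and let $\lambda_{\max}(H)$ be its largest eigenvalue. Consider the relaxation in real variables $x_{ij}=x_{ji}$ (one for each pair of distinct vertices), with $y_{ij}=\tfrac12(1-x_{ij})$: $$\max\ \sum_{ij\in E} w_{ij}\,y_{ij}\quad\text{subject to}\quad M\succeq 0,\quad M_{ii}=3,\quad M_{ij}=2x_{ij}-1\ (i\ne j),$$ and, for all pairwise distinct $i,j,k\in V$, $$0\le x_{ij}+x_{jk}+x_{ik}\le 3,\qquad x_{ij}^2+x_{ik}^2+x_{jk}^2-2(x_{ij}x_{ik}+x_{ij}x_{jk}+x_{ik}x_{jk})+2(x_{ij}+x_{ik}+x_{jk})\le 3 .$$ Algorithm with threshold $t$: take an optimal solution $x$ of the relaxation and put $S=\{ij\in E: y_{ij}>t\}$; take vectors $v_i\in\mathbb R^{V}$ with $\langle v_i,v_j\rangle=M_{ij}$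 (for example from a Cholesky decomposition); sample $R\in\mathbb R^{3\times V}$ with independent standard normal entries and put $(\theta^k_X,\theta^k_Y,\theta^k_Z)=Rv_k/\|Rv_k\|_2$ for $k\in V$ (and $0$ in the null event $Rv_k=0$). Let $$\varrho_S=\prod_{ij\in S}\frac{\mathbb I-X_iX_j-Y_iY_j-Z_iZ_j}{4}\ \prod_{k\ \text{in no edge of}\ S}\frac{\mathbb I+\theta^k_XX_k+\theta^k_YY_k+\theta^k_ZZ_k}{2},\qquad \varrho_{prod}=\prod_{k\in V}\frac{\mathbb I+\theta^k_XX_k+\theta^k_YY_k+\theta^k_ZZ_k}{2},$$ and return $\max\{\operatorname{tr}(H\varrho_S),\operatorname{tr}(H\varrho_{prod})\}$. Theorem. The relaxation has an optimal solution. Let $t=0.771$, let $x$ be any optimal solution, and let $\mathrm{SDP}$ be its objective value. Then $\lambda_{\max}(H)\le\mathrm{SDP}$, the set $S$ is a matching, and vectors $v_i$ as above exist. For every choice of such vectors, $\varrho_S$ and $\varrho_{prod}$ are density matrices, and the returned value is integrable with $$\mathbb E_R\,\max\{\operatorname{tr}(H\varrho_S),\operatorname{tr}(H\varrho_{prod})\}\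 \ge\ 0.526\cdot\mathrm{SDP}\ \ge\ 0.526\cdot\lambda_{\max}(H).$$ -/

import Mathlib

open scoped ComplexOrder

noncomputable section

namespace QMC

/-- Computational basis of the system with one qubit for each vertex. -/
abbrev Basis (V : Type*) : Type _ := V → Fin 2

/-- Operators on the system with one qubit for each vertex. -/
abbrev Op (V : Type*) : Type _ := Matrix (Basis V) (Basis V) ℂ

/-- The Pauli matrices `X`, `Y`, `Z`. -/
def pauli : Fin 3 → Matrix (Fin 2) (Fin 2) ℂ :=
  ![!![0, 1; 1, 0], !![0, -Complex.I; Complex.I, 0], !![1, 0; 0, -1]]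

/-- Density matrices (states). -/
def IsState {V : Type*} [Fintype V] [DecidableEq V] (ρ : Op V) : Prop :=
  ρ.PosSemidef ∧ ρ.trace = 1

/-- The operator that exchanges the qubits at `i` and `j`: it maps the basis vector `b` to
`b ∘ Equiv.swap i j`. -/
def swapOp {V : Type*} [Fintype V] [DecidableEq V] (i j : V) : Op V :=
  Matrix.of fun a b => if a = b ∘ Equiv.swap i j then 1 else 0

/-- The Quantum Max Cut term `(1 - SWAP_ij) / 2` of an unordered pair. -/
def edgeTerm {V : Type*} [Fintype V] [DecidableEq V] : Sym2 V → Op V :=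
  Sym2.lift ⟨fun i j => (1 / 2 : ℂ) • (1 - swapOp i j), fun i j => by
    simp only [swapOp, Equiv.swap_comm i j]⟩

/-- The Quantum Max Cut Hamiltonian (as a maximization problem). -/
def hamiltonian {V : Type*} [Fintype V] [DecidableEq V] (G : SimpleGraph V)
    [DecidableRel G.Adj] (w : Sym2 V → ℝ) : Op V :=
  ∑ e ∈ G.edgeFinset, (w e : ℂ) • edgeTerm e

/-- The expectation value `tr (H ρ)`; it is real when `H` and `ρ` are Hermitian. -/
def energy {V : Type*} [Fintype V] [DecidableEq V] (H ρ : Op V) : ℝ :=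
  (H * ρ).trace.re

/-! ### The relaxation -/

/-- The matrix `M` with `M_ii = 3` and `M_ij = 2 x_ij - 1` for `i ≠ j`. -/
def momentMatrix {V : Type*} [DecidableEq V] (x : Sym2 V → ℝ) : Matrix V V ℝ :=
  Matrix.of fun i j => if i = j then 3 else 2 * x s(i, j) - 1

/-- Feasible points: the Lieb-Mattis and Parekh-Thompson constraints on every triangle and
positivity of the moment matrix. The values of `x` on the diagonal play no role. -/
structure IsFeasible {V : Type*} [DecidableEq V] (x : Sym2 V → ℝ) : Prop where
  lm_nonneg : ∀ i j k : V, i ≠ j → i ≠ k → j ≠ k → 0 ≤ x s(i, j) + x s(j, k) + x s(i, k)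
  lm_le : ∀ i j k : V, i ≠ j → i ≠ k → j ≠ k → x s(i, j) + x s(j, k) + x s(i, k) ≤ 3
  pt : ∀ i j k : V, i ≠ j → i ≠ k → j ≠ k →
    (x s(i, j) ^ 2 + x s(i, k) ^ 2 + x s(j, k) ^ 2)
      - 2 * (x s(i, j) * x s(i, k) + x s(i, j) * x s(j, k) + x s(i, k) * x s(j, k))
      + 2 * (x s(i, j) + x s(i, k) + x s(j, k)) ≤ 3
  psd : (momentMatrix x).PosSemidef

/-- The relaxed value `y_e = (1 - x_e) / 2` of an edge. -/
def edgeValue {V : Type*} (x : Sym2 V → ℝ) (e : Sym2 V) : ℝ := (1 - x e) / 2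

/-- The objective of the relaxation. -/
def relaxValue {V : Type*} [Fintype V] [DecidableEq V] (G : SimpleGraph V)
    [DecidableRel G.Adj] (w x : Sym2 V → ℝ) : ℝ :=
  ∑ e ∈ G.edgeFinset, w e * edgeValue x e

/-- Optimal solutions of the relaxation. -/
def IsOptimal {V : Type*} [Fintype V] [DecidableEq V] (G : SimpleGraph V)
    [DecidableRel G.Adj] (w x : Sym2 V → ℝ) : Prop :=
  IsFeasible x ∧ ∀ x', IsFeasible x' → relaxValue G w x' ≤ relaxValue G w x

/-! ### The rounding algorithm -/

open Classical in
/-- The edges whose relaxed value exceeds the threshold `t`. -/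
def highEdges {V : Type*} [Fintype V] [DecidableEq V] (G : SimpleGraph V)
    [DecidableRel G.Adj] (t : ℝ) (x : Sym2 V → ℝ) : Finset (Sym2 V) :=
  G.edgeFinset.filter fun e => t < edgeValue x e

/-- No two different edges of `S` share a vertex. -/
def IsMatching {V : Type*} (S : Finset (Sym2 V)) : Prop :=
  ∀ e ∈ S, ∀ f ∈ S, ∀ k : V, k ∈ e → k ∈ f → e = f

/-- The vectors `v_i` in `ℝ^V` satisfy `M_ij = ⟨v_i, v_j⟩`. -/
def IsGram {V : Type*} [Fintype V] (M : Matrix V V ℝ) (v : V → V → ℝ) : Prop :=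
  ∀ i j, M i j = ∑ l, v i l * v j l

/-- The Bloch vector `R v_k / ‖R v_k‖₂`, with value `0` in the null event `R v_k = 0`. -/
def bloch {V : Type*} [Fintype V] (v : V → V → ℝ) (R : Fin 3 → V → ℝ) (k : V) : Fin 3 → ℝ :=
  fun a => (∑ l, R a l * v k l) / Real.sqrt (∑ b, (∑ l, R b l * v k l) ^ 2)

/-- The one-qubit operator `(1 + θ_X X + θ_Y Y + θ_Z Z) / 2`. -/
def qubitState (θ : Fin 3 → ℝ) : Matrix (Fin 2) (Fin 2) ℂ :=
  (1 / 2 : ℂ) • (1 + ∑ a, (θ a : ℂ) • pauli a)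

/-- The `(a, b)` entry of the singlet `(1 - X_i X_j - Y_i Y_j - Z_i Z_j) / 4` on the qubits of an
unordered pair; it depends only on the two coordinates of `a` and `b` in this pair. -/
def singletEntry {V : Type*} (a b : Basis V) : Sym2 V → ℂ :=
  Sym2.lift ⟨fun i j => (1 / 4 : ℂ) *
      ((1 : Matrix (Fin 2) (Fin 2) ℂ) (a i) (b i) * (1 : Matrix (Fin 2) (Fin 2) ℂ) (a j) (b j)
        - ∑ p, pauli p (a i) (b i) * pauli p (a j) (b j)), fun i j => by
    simp only [mul_comm]⟩

/-- The tensor product of the singlets on the edges of the matching `S` with the one-qubit states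
on the vertices which no edge of `S` contains (entries of a tensor product are products of the
entries of its factors). -/
def matchedState {V : Type*} [Fintype V] [DecidableEq V] (S : Finset (Sym2 V))
    (θ : V → Fin 3 → ℝ) : Op V :=
  Matrix.of fun a b => (∏ e ∈ S, singletEntry a b e) *
    ∏ k ∈ Finset.univ.filter (fun k : V => ∀ e ∈ S, k ∉ e), qubitState (θ k) (a k) (b k)

/-- The tensor product of the one-qubit states. -/
def productState {V : Type*} [Fintype V] (θ : V → Fin 3 → ℝ) : Op V :=
  Matrix.of fun a b => ∏ k, qubitState (θ k) (a k) (b k)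

/-- The law of a `3 × V` matrix with independent standard normal entries. -/
def gaussianMatrix (V : Type*) [Fintype V] : MeasureTheory.Measure (Fin 3 → V → ℝ) :=
  MeasureTheory.Measure.pi fun _ => MeasureTheory.Measure.pi fun _ =>
    ProbabilityTheory.gaussianReal 0 1

/-- The value returned by the algorithm with threshold `t`, for the solution `x` of the
relaxation, the vectors `v` and the sample `R`. -/
def algorithmValue {V : Type*} [Fintype V] [DecidableEq V] (G : SimpleGraph V)
    [DecidableRel G.Adj] (w : Sym2 V → ℝ) (t : ℝ) (x : Sym2 V → ℝ) (v : V → V → ℝ)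
    (R : Fin 3 → V → ℝ) : ℝ :=
  max (energy (hamiltonian G w) (matchedState (highEdges G t x) (bloch v R)))
    (energy (hamiltonian G w) (productState (bloch v R)))

end QMC

end

/-!
Both states that the algorithm prepares have explicit energies. In the product state the term of an
edge `ij` has energy `(1 - θ_i · θ_j) / 4`. In the matched state it has energy `1` on `S`, `1 / 4`
if `ij` is not in `S` but meets it (one of the two qubits is then maximally mixed and independent of
the other), and the product value if both vertices are unmatched (`energy_matchedState`). Writing
`(1 ⊗ 1 - X ⊗ X - Y ⊗ Y - Z ⊗ Z) / 4` for a singlet removes the edges of the matching one at a time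
from the traces.

The relaxation bounds `λ_max(H)`: the Hamiltonian is a real matrix, and the expectation values of
the swaps in a real eigenvector form a feasible point. Positivity of `M` is `2 SWAP - 1 = XX + YY + ZZ`,
and the triangle constraints follow from the positivity of the Gram matrix of `ψ` and its images
under the three swaps, which is determined by the swap expectations because the antisymmetrizer of
three qubits vanishes (`triangle_swapExpectation`). In terms of the values `y`, the triangle
constraints give `y_ij + y_ik ≤ 3 / 2` for edges that share a vertex. Hence `S` is a matching, and
`y_e ≤ 1.5 - 0.771 = 0.729` for an edge `e ∉ S` that meets `S`.

The expected inner product of two Bloch vectors whose Gaussian vectors have correlation `ρ` is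
`(4 ρ / π) ∫_0^∞ (1 + t²)⁻² (1 + (1 - ρ²) t²)^(-1/2) dt` (`integral_normalized_inner`). Indeed
`1 / √n` is proportional to `∫_0^∞ exp(-t² n / 2) dt`; after exchanging the integrals the Gaussian
expectation is explicit, and one of the two remaining integrals is elementary. The formula gives
three bounds: the correlation is at most `ρ` for `ρ ≥ 0`, and for `ρ = -r ≤ 0` it is at most the
negative of its Taylor polynomial in `r` and at most `1 - 2 r`, the tangent at `r = 1`.

The maximum of the two energies is at least their convex combination with weights `0.059` and
`0.941`, and this combination has the ratio `0.526` on each edge: the singlets pay for the large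
values, where the product state is worst, while edges that meet `S` have `y ≤ 0.729` and can afford
the loss, and on the remaining edges `y ≤ 0.771` lets the product state alone suffice
(`ratio_le_edge`).
-/

noncomputable section

namespace QMC

/-! ### Singlets on a matching -/

/-- The tensor product of the singlets on the edges of `S` with arbitrary one-qubit operators `τ k`
on the vertices which no edge of `S` contains; `matchedState` is the case
`τ k = qubitState (θ k)`. -/
def matchedOp {V : Type*} [Fintype V] [DecidableEq V] (S : Finset (Sym2 V))
    (τ : V → Matrix (Fin 2) (Fin 2) ℂ) : Op V :=
  Matrix.of fun a b => (∏ e ∈ S, singletEntry a b e) *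
    ∏ k ∈ Finset.univ.filter (fun k : V => ∀ e ∈ S, k ∉ e), τ k (a k) (b k)

/-- The vertices which no edge of `S` contains. -/
def unmatched {V : Type*} [Fintype V] [DecidableEq V] (S : Finset (Sym2 V)) : Finset V :=
  Finset.univ.filter fun k : V => ∀ e ∈ S, k ∉ e

section Matched

variable {V : Type*}

/-- The pairs of a matching are edges of a simple graph and pairwise disjoint. -/
structure IsLooplessMatching (S : Finset (Sym2 V)) : Prop where
  matching : IsMatching S
  not_isDiag : ∀ e ∈ S, ¬ e.IsDiag

lemma IsLooplessMatching.ne {S : Finset (Sym2 V)} {i j : V}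
    (h : IsLooplessMatching S) (he : s(i, j) ∈ S) : i ≠ j := by
  have := h.not_isDiag _ he
  simpa using this

variable [DecidableEq V]

lemma IsLooplessMatching.of_insert {S : Finset (Sym2 V)} {e : Sym2 V}
    (h : IsLooplessMatching (insert e S)) : IsLooplessMatching S :=
  ⟨fun a ha b hb => h.matching a (Finset.mem_insert_of_mem ha) b (Finset.mem_insert_of_mem hb),
    fun a ha => h.not_isDiag a (Finset.mem_insert_of_mem ha)⟩

/-- The family `τ` with the operators at `i` and `j` replaced by `A`. -/
def setPair (τ : V → Matrix (Fin 2) (Fin 2) ℂ) (i j : V) (A : Matrix (Fin 2) (Fin 2) ℂ) :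
    V → Matrix (Fin 2) (Fin 2) ℂ :=
  Function.update (Function.update τ i A) j A

lemma setPair_left (τ : V → Matrix (Fin 2) (Fin 2) ℂ) (i j : V) (A : Matrix (Fin 2) (Fin 2) ℂ) :
    setPair τ i j A i = A := by
  by_cases h : i = j
  · subst h; simp [setPair]
  · simp [setPair, h]

lemma setPair_right (τ : V → Matrix (Fin 2) (Fin 2) ℂ) (i j : V) (A : Matrix (Fin 2) (Fin 2) ℂ) :
    setPair τ i j A j = A := by
  simp [setPair]

lemma setPair_of_ne (τ : V → Matrix (Fin 2) (Fin 2) ℂ) {i j k : V}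
    (A : Matrix (Fin 2) (Fin 2) ℂ) (hi : k ≠ i) (hj : k ≠ j) : setPair τ i j A k = τ k := by
  simp [setPair, hi, hj]

lemma prod_trace_setPair {T : Finset V} {i j : V} (hij : i ≠ j) (hi : i ∈ T) (hj : j ∈ T)
    (τ : V → Matrix (Fin 2) (Fin 2) ℂ) (A : Matrix (Fin 2) (Fin 2) ℂ) :
    ∏ k ∈ T, (setPair τ i j A k).trace =
      A.trace * A.trace * ∏ k ∈ (T.erase i).erase j, (τ k).trace := by
  have hj' : j ∈ T.erase i := Finset.mem_erase.2 ⟨hij.symm, hj⟩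
  rw [← Finset.mul_prod_erase _ _ hi, ← Finset.mul_prod_erase _ _ hj', setPair_left,
    setPair_right, mul_assoc]
  congr 2
  refine Finset.prod_congr rfl fun k hk => ?_
  simp only [Finset.mem_erase] at hk
  rw [setPair_of_ne _ _ hk.2.1 hk.1]

variable [Fintype V]

lemma mem_unmatched {S : Finset (Sym2 V)} {k : V} : k ∈ unmatched S ↔ ∀ e ∈ S, k ∉ e := by
  simp [unmatched]

lemma unmatched_empty : unmatched (∅ : Finset (Sym2 V)) = Finset.univ := by
  simp [unmatched]

lemma unmatched_insert {S : Finset (Sym2 V)} (i j : V) :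
    unmatched (insert s(i, j) S) = ((unmatched S).erase i).erase j := by
  ext k
  simp only [mem_unmatched, Finset.mem_insert, forall_eq_or_imp, Sym2.mem_iff, not_or,
    Finset.mem_erase]
  tauto

/-- A singlet is the combination `(1 ⊗ 1 - X ⊗ X - Y ⊗ Y - Z ⊗ Z) / 4` of product operators, so one
edge of the matching can be traded for four operators with a smaller matching. -/
lemma matchedOp_insert {S : Finset (Sym2 V)} {i j : V} (hij : i ≠ j) (hS : s(i, j) ∉ S)
    (hi : i ∈ unmatched S) (hj : j ∈ unmatched S) (τ : V → Matrix (Fin 2) (Fin 2) ℂ) :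
    matchedOp (insert s(i, j) S) τ = (1 / 4 : ℂ) • (matchedOp S (setPair τ i j 1)
      - ∑ p, matchedOp S (setPair τ i j (pauli p))) := by
  have key : ∀ (A : Matrix (Fin 2) (Fin 2) ℂ) (a b : Basis V),
      ∏ k ∈ unmatched S, setPair τ i j A k (a k) (b k) = A (a i) (b i) * A (a j) (b j) *
        ∏ k ∈ unmatched (insert s(i, j) S), τ k (a k) (b k) := by
    intro A a b
    have hj' : j ∈ (unmatched S).erase i := Finset.mem_erase.2 ⟨hij.symm, hj⟩
    rw [← Finset.mul_prod_erase _ _ hi, ← Finset.mul_prod_erase _ _ hj', setPair_left,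
      setPair_right, unmatched_insert, mul_assoc]
    congr 2
    refine Finset.prod_congr rfl fun k hk => ?_
    simp only [Finset.mem_erase] at hk
    rw [setPair_of_ne _ _ hk.2.1 hk.1]
  ext a b
  have h1 : ∀ (T : Finset (Sym2 V)) (σ : V → Matrix (Fin 2) (Fin 2) ℂ), matchedOp T σ a b =
    (∏ e ∈ T, singletEntry a b e) * ∏ k ∈ unmatched T, σ k (a k) (b k) := fun _ _ => rfl
  simp only [Matrix.smul_apply, Matrix.sub_apply, Matrix.sum_apply, h1, key,
    Finset.prod_insert hS, smul_eq_mul]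
  simp only [singletEntry, Sym2.lift_mk, Fin.sum_univ_three]
  ring

lemma IsLooplessMatching.mem_unmatched_of_insert {S : Finset (Sym2 V)} {e : Sym2 V} {k : V}
    (h : IsLooplessMatching (insert e S)) (he : e ∉ S) (hk : k ∈ e) : k ∈ unmatched S := by
  rw [mem_unmatched]
  intro f hf hkf
  have := h.matching e (Finset.mem_insert_self _ _) f (Finset.mem_insert_of_mem hf) k hk hkf
  exact he (this ▸ hf)

lemma trace_pauli (p : Fin 3) : (pauli p).trace = 0 := by
  fin_cases p <;> simp [pauli, Matrix.trace, Fin.sum_univ_two]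

/-- If a linear functional `Λ` takes the trace of product operators outside of `A`, it does so for
matchings that avoid `A`: the singlets contribute the factor `1`. -/
lemma apply_matchedOp_of_disjoint (Λ : Op V →ₗ[ℂ] ℂ) (A : Finset V)
    (c : (V → Matrix (Fin 2) (Fin 2) ℂ) → ℂ)
    (hc : ∀ τ τ', (∀ k ∈ A, τ k = τ' k) → c τ = c τ')
    (h0 : ∀ τ, Λ (matchedOp ∅ τ) = c τ * ∏ k ∈ Finset.univ \ A, (τ k).trace)
    (S : Finset (Sym2 V)) (hS : IsLooplessMatching S) (hA : A ⊆ unmatched S)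
    (τ : V → Matrix (Fin 2) (Fin 2) ℂ) :
    Λ (matchedOp S τ) = c τ * ∏ k ∈ unmatched S \ A, (τ k).trace := by
  induction S using Finset.induction_on generalizing τ with
  | empty => rw [h0, unmatched_empty]
  | insert e S he ih =>
    induction e using Sym2.ind with
    | _ i j =>
    have hij : i ≠ j := hS.ne (Finset.mem_insert_self _ _)
    have hi := hS.mem_unmatched_of_insert he (k := i) (by simp)
    have hj := hS.mem_unmatched_of_insert he (k := j) (by simp)
    rw [unmatched_insert] at hA
    have hiA : i ∉ A := fun h => by simpa using hA h
    have hjA : j ∉ A := fun h => by simpa using hA h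
    have hA' : A ⊆ unmatched S :=
      hA.trans ((Finset.erase_subset _ _).trans (Finset.erase_subset _ _))
    have hcs : ∀ B, c (setPair τ i j B) = c τ := fun B => hc _ _ fun k hk =>
      setPair_of_ne _ _ (fun h => hiA (h ▸ hk)) (fun h => hjA (h ▸ hk))
    have hset : ((unmatched S \ A).erase i).erase j = unmatched (insert s(i, j) S) \ A := by
      rw [unmatched_insert]
      ext k
      simp only [Finset.mem_erase, Finset.mem_sdiff]
      tauto
    rw [matchedOp_insert hij he hi hj, map_smul, map_sub, map_sum, ih hS.of_insert hA']
    simp only [ih hS.of_insert hA', hcs, prod_trace_setPair hij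
      (Finset.mem_sdiff.2 ⟨hi, hiA⟩) (Finset.mem_sdiff.2 ⟨hj, hjA⟩), trace_pauli, hset]
    simp
    ring

/-- The expectation value of the swap of the qubits `i` and `j`. -/
def swapTrace (i j : V) : Op V →ₗ[ℂ] ℂ where
  toFun M := ∑ b, M b (b ∘ Equiv.swap i j)
  map_add' M N := by simp [Finset.sum_add_distrib]
  map_smul' c M := by simp [Finset.mul_sum]

lemma trace_swapOp_mul (i j : V) (M : Op V) : (swapOp i j * M).trace = swapTrace i j M := by
  simp only [Matrix.trace, Matrix.diag, Matrix.mul_apply, swapOp, Matrix.of_apply, ite_mul,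
    one_mul, zero_mul, swapTrace, LinearMap.coe_mk, AddHom.coe_mk]
  rw [Finset.sum_comm]
  simp

lemma matchedOp_empty_apply (τ : V → Matrix (Fin 2) (Fin 2) ℂ) (a b : Basis V) :
    matchedOp ∅ τ a b = ∏ k, τ k (a k) (b k) := by
  simp [matchedOp]

lemma trace_matchedOp_empty (τ : V → Matrix (Fin 2) (Fin 2) ℂ) :
    (matchedOp ∅ τ).trace = ∏ k, (τ k).trace := by
  simp only [Matrix.trace, Matrix.diag, matchedOp_empty_apply]
  rw [Finset.prod_univ_sum]
  simp

lemma swapTrace_matchedOp_empty {i j : V} (hij : i ≠ j) (τ : V → Matrix (Fin 2) (Fin 2) ℂ) :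
    swapTrace i j (matchedOp ∅ τ) =
      (τ i * τ j).trace * ∏ k ∈ Finset.univ \ {i, j}, (τ k).trace := by
  -- the entries of `τ i` and `τ j` are expanded so that the sum over `b` factorizes
  have key : ∀ b : Basis V, ∏ k, τ k (b k) ((b ∘ Equiv.swap i j) k) =
      ∑ c : Fin 2, ∑ d : Fin 2, τ i c d * τ j d c *
        ∏ k, (if k = i then (if b k = c then 1 else 0) else
          if k = j then (if b k = d then 1 else 0) else τ k (b k) (b k)) := by
    intro b
    have hj' : j ∈ Finset.univ.erase i := Finset.mem_erase.2 ⟨hij.symm, Finset.mem_univ _⟩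
    have h1 : ∀ f : V → ℂ, ∏ k, f k = f i * (f j * ∏ k ∈ (Finset.univ.erase i).erase j, f k) := by
      intro f
      rw [← Finset.mul_prod_erase _ _ (Finset.mem_univ i), ← Finset.mul_prod_erase _ _ hj']
    simp only [h1, if_true, hij.symm, if_false, Function.comp_apply, Equiv.swap_apply_left,
      Equiv.swap_apply_right]
    have h2 : ∏ k ∈ (Finset.univ.erase i).erase j, τ k (b k) (b (Equiv.swap i j k)) =
        ∏ k ∈ (Finset.univ.erase i).erase j, τ k (b k) (b k) := by
      refine Finset.prod_congr rfl fun k hk => ?_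
      simp only [Finset.mem_erase] at hk
      rw [Equiv.swap_apply_of_ne_of_ne hk.2.1 hk.1]
    have h3 : ∀ c d : Fin 2, ∏ k ∈ (Finset.univ.erase i).erase j,
        (if k = i then (if b k = c then (1 : ℂ) else 0) else
          if k = j then (if b k = d then 1 else 0) else τ k (b k) (b k)) =
        ∏ k ∈ (Finset.univ.erase i).erase j, τ k (b k) (b k) := by
      intro c d
      refine Finset.prod_congr rfl fun k hk => ?_
      simp only [Finset.mem_erase] at hk
      simp [hk.1, hk.2.1]
    simp only [h2, h3]
    rw [Finset.sum_eq_single (b i), Finset.sum_eq_single (b j)]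
    · simp [mul_assoc]
    · intro d _ hd; simp [hd.symm]
    · simp
    · intro c _ hc; simp [hc.symm]
    · simp
  have hsum : ∀ c d : Fin 2, ∑ b : Basis V,
      ∏ k, (if k = i then (if b k = c then (1 : ℂ) else 0) else
          if k = j then (if b k = d then 1 else 0) else τ k (b k) (b k)) =
      ∏ k ∈ Finset.univ \ {i, j}, (τ k).trace := by
    intro c d
    have h4 := Finset.prod_univ_sum (fun _ : V => (Finset.univ : Finset (Fin 2)))
      (fun k β => if k = i then (if β = c then (1 : ℂ) else 0) else
          if k = j then (if β = d then 1 else 0) else τ k β β)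
    simp only [Fintype.piFinset_univ] at h4
    rw [← h4, ← Finset.prod_sdiff (Finset.subset_univ ({i, j} : Finset V)),
      Finset.prod_pair hij]
    have h5 : ∏ k ∈ Finset.univ \ {i, j}, ∑ β, (if k = i then (if β = c then (1 : ℂ) else 0) else
          if k = j then (if β = d then 1 else 0) else τ k β β) =
          ∏ k ∈ Finset.univ \ {i, j}, (τ k).trace := by
      refine Finset.prod_congr rfl fun k hk => ?_
      simp only [Finset.mem_sdiff, Finset.mem_insert, Finset.mem_singleton, not_or] at hk
      simp [hk.2.1, hk.2.2, Matrix.trace]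
    rw [h5]
    simp [hij.symm]
  simp only [swapTrace, LinearMap.coe_mk, AddHom.coe_mk, matchedOp_empty_apply, key]
  rw [Finset.sum_comm]
  simp_rw [Finset.sum_comm (s := (Finset.univ : Finset (Basis V))), ← Finset.mul_sum, hsum,
    ← Finset.sum_mul]
  simp [Matrix.trace, Matrix.mul_apply]

/-- Singlets have trace `1`. -/
lemma trace_matchedOp {S : Finset (Sym2 V)} (hS : IsLooplessMatching S)
    (τ : V → Matrix (Fin 2) (Fin 2) ℂ) :
    (matchedOp S τ).trace = ∏ k ∈ unmatched S, (τ k).trace := by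
  have := apply_matchedOp_of_disjoint (Matrix.traceLinearMap (Basis V) ℂ ℂ) ∅ (fun _ => 1)
    (fun _ _ _ => rfl) (fun τ => by simp [trace_matchedOp_empty]) S hS (by simp) τ
  simpa using this

lemma swapTrace_matchedOp_of_unmatched {S : Finset (Sym2 V)} (hS : IsLooplessMatching S)
    {i j : V} (hij : i ≠ j) (hi : i ∈ unmatched S) (hj : j ∈ unmatched S)
    (τ : V → Matrix (Fin 2) (Fin 2) ℂ) :
    swapTrace i j (matchedOp S τ) =
      (τ i * τ j).trace * ∏ k ∈ unmatched S \ {i, j}, (τ k).trace :=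
  apply_matchedOp_of_disjoint (swapTrace i j) {i, j} (fun τ => (τ i * τ j).trace)
    (fun τ τ' h => by rw [h i (by simp), h j (by simp)]) (swapTrace_matchedOp_empty hij) S hS
    (by intro k hk; simp only [Finset.mem_insert, Finset.mem_singleton] at hk
        rcases hk with rfl | rfl <;> assumption) τ

lemma trace_pauli_mul_self (p : Fin 3) : (pauli p * pauli p).trace = 2 := by
  fin_cases p <;> simp [pauli, Matrix.trace, Fin.sum_univ_two] <;> norm_num

/-- A singlet is antisymmetric under the exchange of its two qubits. -/
lemma swapTrace_matchedOp_of_mem {S : Finset (Sym2 V)} (hS : IsLooplessMatching S)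
    {i j : V} (he : s(i, j) ∈ S) (τ : V → Matrix (Fin 2) (Fin 2) ℂ) :
    swapTrace i j (matchedOp S τ) = - ∏ k ∈ unmatched S, (τ k).trace := by
  obtain ⟨T, heT, rfl⟩ : ∃ T, s(i, j) ∉ T ∧ S = insert s(i, j) T :=
    ⟨S.erase s(i, j), by simp, (Finset.insert_erase he).symm⟩
  have hij : i ≠ j := hS.ne he
  have hi := hS.mem_unmatched_of_insert heT (k := i) (by simp)
  have hj := hS.mem_unmatched_of_insert heT (k := j) (by simp)
  have hset : unmatched T \ {i, j} = unmatched (insert s(i, j) T) := by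
    rw [unmatched_insert]
    ext k
    simp only [Finset.mem_erase, Finset.mem_sdiff, Finset.mem_insert, Finset.mem_singleton]
    tauto
  have hprod : ∀ B, ∏ k ∈ unmatched (insert s(i, j) T), (setPair τ i j B k).trace =
      ∏ k ∈ unmatched (insert s(i, j) T), (τ k).trace := by
    intro B
    refine Finset.prod_congr rfl fun k hk => ?_
    rw [unmatched_insert] at hk
    simp only [Finset.mem_erase] at hk
    rw [setPair_of_ne _ _ hk.2.1 hk.1]
  rw [matchedOp_insert hij heT hi hj, map_smul, map_sub, map_sum]
  simp only [swapTrace_matchedOp_of_unmatched hS.of_insert hij hi hj, setPair_left, setPair_right,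
    trace_pauli_mul_self, hset, hprod]
  simp
  ring

lemma swapTrace_comm (i j : V) : swapTrace i j = swapTrace j i := by
  simp only [swapTrace, Equiv.swap_comm i j]

/-- If `i` belongs to an edge of the matching that does not contain `j`, the qubit at `i` is
maximally mixed and independent of the one at `j`; here `j` is unmatched. -/
lemma swapTrace_matchedOp_of_matched_left {S : Finset (Sym2 V)} (hS : IsLooplessMatching S)
    {i j l : V} (he : s(i, l) ∈ S) (hj : j ∈ unmatched S)
    (τ : V → Matrix (Fin 2) (Fin 2) ℂ) :
    swapTrace i j (matchedOp S τ) = 1 / 2 * ∏ k ∈ unmatched S, (τ k).trace := by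
  have hjl : j ∉ s(i, l) := mem_unmatched.1 hj _ he
  simp only [Sym2.mem_iff, not_or] at hjl
  obtain ⟨T, heT, rfl⟩ : ∃ T, s(i, l) ∉ T ∧ S = insert s(i, l) T :=
    ⟨S.erase s(i, l), by simp, (Finset.insert_erase he).symm⟩
  have hil : i ≠ l := hS.ne he
  have hi := hS.mem_unmatched_of_insert heT (k := i) (by simp)
  have hl := hS.mem_unmatched_of_insert heT (k := l) (by simp)
  have hj' : j ∈ unmatched T := by
    rw [unmatched_insert] at hj
    simp only [Finset.mem_erase] at hj
    exact hj.2.2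
  have hset : (unmatched T \ {i, j}) = insert l ((unmatched (insert s(i, l) T)).erase j) := by
    rw [unmatched_insert]
    ext k
    simp only [Finset.mem_erase, Finset.mem_sdiff, Finset.mem_insert, Finset.mem_singleton]
    by_cases hk : k = l
    · subst hk; simp [hl, hil.symm, Ne.symm hjl.2]
    · tauto
  have hprod : ∀ B, ∏ k ∈ unmatched T \ {i, j}, (setPair τ i l B k).trace =
      B.trace * ∏ k ∈ (unmatched (insert s(i, l) T)).erase j, (τ k).trace := by
    intro B
    rw [hset, Finset.prod_insert (by simp [unmatched_insert]), setPair_right]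
    congr 1
    refine Finset.prod_congr rfl fun k hk => ?_
    rw [unmatched_insert] at hk
    simp only [Finset.mem_erase] at hk
    rw [setPair_of_ne _ _ hk.2.2.1 hk.2.1]
  rw [matchedOp_insert hil heT hi hl, map_smul, map_sub, map_sum]
  simp only [swapTrace_matchedOp_of_unmatched hS.of_insert (Ne.symm hjl.1) hi hj', setPair_left,
    setPair_of_ne τ _ hjl.1 hjl.2, hprod, trace_pauli]
  rw [← Finset.mul_prod_erase _ _ hj]
  simp
  ring

/-- Qubits of different blocks of which one is a singlet have swap expectation `1 / 2`. -/
lemma swapTrace_matchedOp_of_matched {S : Finset (Sym2 V)} (hS : IsLooplessMatching S)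
    {i j l : V} (he : s(i, l) ∈ S) (hji : j ≠ i) (hjl : j ≠ l)
    (τ : V → Matrix (Fin 2) (Fin 2) ℂ) :
    swapTrace i j (matchedOp S τ) = 1 / 2 * ∏ k ∈ unmatched S, (τ k).trace := by
  by_cases hj : j ∈ unmatched S
  · exact swapTrace_matchedOp_of_matched_left hS he hj τ
  obtain ⟨T, heT, rfl⟩ : ∃ T, s(i, l) ∉ T ∧ S = insert s(i, l) T :=
    ⟨S.erase s(i, l), by simp, (Finset.insert_erase he).symm⟩
  have hil : i ≠ l := hS.ne he
  have hi := hS.mem_unmatched_of_insert heT (k := i) (by simp)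
  have hl := hS.mem_unmatched_of_insert heT (k := l) (by simp)
  obtain ⟨m, hm⟩ : ∃ m, s(j, m) ∈ T := by
    have : j ∉ unmatched T := fun h => hj (by
      rw [unmatched_insert]; simp [h, hji, hjl])
    rw [mem_unmatched] at this
    push Not at this
    obtain ⟨f, hf, hjf⟩ := this
    exact ⟨Sym2.Mem.other hjf, by rwa [Sym2.other_spec hjf]⟩
  rw [matchedOp_insert hil heT hi hl, map_smul, map_sub, map_sum, swapTrace_comm]
  simp only [swapTrace_matchedOp_of_matched_left hS.of_insert hm hi,
    prod_trace_setPair hil hi hl, trace_pauli, ← unmatched_insert]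
  simp
  ring

end Matched

/-! ### Energies of matched states -/

section Energy

lemma trace_qubitState (θ : Fin 3 → ℝ) : (qubitState θ).trace = 1 := by
  simp [qubitState, Matrix.trace_smul, Matrix.trace_add, Matrix.trace_sum, trace_pauli]

lemma qubitState_eq (θ : Fin 3 → ℝ) : qubitState θ =
    !![(1 + θ 2 : ℂ) / 2, (θ 0 - θ 1 * Complex.I) / 2;
       (θ 0 + θ 1 * Complex.I) / 2, (1 - θ 2 : ℂ) / 2] := by
  ext a b
  fin_cases a <;> fin_cases b <;>
    simp [qubitState, pauli, Fin.sum_univ_three, Matrix.add_apply, Matrix.smul_apply] <;> ring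

lemma trace_qubitState_mul (θ η : Fin 3 → ℝ) :
    (qubitState θ * qubitState η).trace = ((1 + ∑ a, θ a * η a : ℝ) / 2 : ℂ) := by
  rw [qubitState_eq, qubitState_eq]
  simp only [Matrix.trace, Matrix.diag, Fin.sum_univ_two, Matrix.mul_apply, Fin.sum_univ_three]
  simp
  linear_combination (-(θ 1 : ℂ) * η 1 / 2) * Complex.I_sq

variable {V : Type*}

/-- The energy of the term of an unordered pair in a product state with Bloch vectors `θ`. -/
def productValue (θ : V → Fin 3 → ℝ) : Sym2 V → ℝ :=
  Sym2.lift ⟨fun i j => (1 - ∑ a, θ i a * θ j a) / 4, fun i j => by simp only [mul_comm]⟩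

lemma isLooplessMatching_empty : IsLooplessMatching (∅ : Finset (Sym2 V)) :=
  ⟨by simp [IsMatching], by simp⟩

variable [Fintype V] [DecidableEq V]

/-- The energy of the term of a pair in `matchedState S θ`: it is `1` on the matching, `1 / 4` for
other pairs that meet the matching, and that of the product state for the remaining pairs. -/
def matchedValue (S : Finset (Sym2 V)) (θ : V → Fin 3 → ℝ) (e : Sym2 V) : ℝ :=
  if e ∈ S then 1 else if e.toFinset ⊆ unmatched S then productValue θ e else 1 / 4

lemma trace_edgeTerm_mul (i j : V) (M : Op V) :
    (edgeTerm s(i, j) * M).trace = 1 / 2 * (M.trace - swapTrace i j M) := by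
  simp only [edgeTerm, Sym2.lift_mk, smul_mul_assoc, sub_mul, one_mul, Matrix.trace_smul,
    Matrix.trace_sub, trace_swapOp_mul, smul_eq_mul]

lemma matchedState_eq (S : Finset (Sym2 V)) (θ : V → Fin 3 → ℝ) :
    matchedState S θ = matchedOp S fun k => qubitState (θ k) := rfl

lemma productState_eq (θ : V → Fin 3 → ℝ) : productState θ = matchedState ∅ θ := by
  ext a b
  simp [productState, matchedState]

lemma trace_matchedState {S : Finset (Sym2 V)} (hS : IsLooplessMatching S)
    (θ : V → Fin 3 → ℝ) : (matchedState S θ).trace = 1 := by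
  rw [matchedState_eq, trace_matchedOp hS]
  simp [trace_qubitState]

lemma trace_edgeTerm_mul_matchedState {S : Finset (Sym2 V)} (hS : IsLooplessMatching S)
    (θ : V → Fin 3 → ℝ) {e : Sym2 V} (he : ¬ e.IsDiag) :
    (edgeTerm e * matchedState S θ).trace = matchedValue S θ e := by
  induction e using Sym2.ind with
  | _ i j =>
  have hij : i ≠ j := by simpa using he
  rw [trace_edgeTerm_mul, trace_matchedState hS, matchedState_eq, matchedValue]
  have h1 : ∀ T : Finset V, ∏ k ∈ T, (qubitState (θ k)).trace = 1 := fun T => by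
    simp [trace_qubitState]
  split_ifs with hmem hsub
  · rw [swapTrace_matchedOp_of_mem hS hmem, h1]
    norm_num
  · have hi : i ∈ unmatched S := hsub (by simp)
    have hj : j ∈ unmatched S := hsub (by simp)
    rw [swapTrace_matchedOp_of_unmatched hS hij hi hj, h1, trace_qubitState_mul]
    simp only [productValue, Sym2.lift_mk]
    push_cast
    ring
  · have hcase : i ∉ unmatched S ∨ j ∉ unmatched S := by
      by_contra hcon
      push Not at hcon
      refine hsub fun k hk => ?_
      simp only [Sym2.mem_toFinset, Sym2.mem_iff] at hk
      rcases hk with rfl | rfl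
      · exact hcon.1
      · exact hcon.2
    have hex : ∀ k, k ∉ unmatched S → ∃ l, s(k, l) ∈ S := by
      intro k hk
      rw [mem_unmatched] at hk
      push Not at hk
      obtain ⟨f, hf, hkf⟩ := hk
      exact ⟨Sym2.Mem.other hkf, by rwa [Sym2.other_spec hkf]⟩
    have hval : swapTrace i j (matchedOp S fun k => qubitState (θ k)) = 1 / 2 := by
      rcases hcase with hi | hj
      · obtain ⟨l, hl⟩ := hex i hi
        rw [swapTrace_matchedOp_of_matched hS hl hij.symm (by rintro rfl; exact hmem hl), h1,
          mul_one]
      · obtain ⟨l, hl⟩ := hex j hj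
        rw [swapTrace_comm, swapTrace_matchedOp_of_matched hS hl hij
          (by rintro rfl; exact hmem (by rwa [Sym2.eq_swap])), h1, mul_one]
    rw [hval]
    norm_num

lemma energy_matchedState (G : SimpleGraph V) [DecidableRel G.Adj] (w : Sym2 V → ℝ)
    {S : Finset (Sym2 V)} (hS : IsLooplessMatching S) (θ : V → Fin 3 → ℝ) :
    energy (hamiltonian G w) (matchedState S θ) =
      ∑ e ∈ G.edgeFinset, w e * matchedValue S θ e := by
  rw [energy, hamiltonian, Finset.sum_mul, Matrix.trace_sum, Complex.re_sum]
  refine Finset.sum_congr rfl fun e he => ?_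
  rw [smul_mul_assoc, Matrix.trace_smul, trace_edgeTerm_mul_matchedState hS θ
    (G.not_isDiag_of_mem_edgeFinset he), smul_eq_mul, ← Complex.ofReal_mul, Complex.ofReal_re]

lemma energy_productState (G : SimpleGraph V) [DecidableRel G.Adj] (w : Sym2 V → ℝ)
    (θ : V → Fin 3 → ℝ) :
    energy (hamiltonian G w) (productState θ) = ∑ e ∈ G.edgeFinset, w e * productValue θ e := by
  rw [productState_eq, energy_matchedState G w isLooplessMatching_empty]
  simp [matchedValue, unmatched_empty]

end Energy

/-! ### Positivity of matched states -/

section Positivity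

/-- The singlet is the projection onto an antisymmetric vector. -/
lemma exists_singletEntry_eq {V : Type*} (e : Sym2 V) :
    ∃ u : Basis V → ℂ, ∀ a b, singletEntry a b e = star (u a) * u b := by
  induction e using Sym2.ind with
  | _ i j =>
  have h2 : ((√2 : ℝ) : ℂ) ^ 2 = 2 := by
    rw [← Complex.ofReal_pow, Real.sq_sqrt (by norm_num)]
    norm_num
  refine ⟨fun b => (if b i = b j then 0 else if b i = 0 then 1 else -1) * ((√2 : ℝ) : ℂ) / 2,
    fun a b => ?_⟩
  simp only [singletEntry, Sym2.lift_mk]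
  generalize a i = x
  generalize a j = y
  generalize b i = z
  generalize b j = t
  fin_cases x <;> fin_cases y <;> fin_cases z <;> fin_cases t <;>
    simp [pauli, Fin.sum_univ_three] <;>
    first | linear_combination (1 / 4 : ℂ) * h2 | linear_combination (-1 / 4 : ℂ) * h2

/-- Pure one-qubit states and the maximally mixed state are positive. -/
lemma exists_qubitState_eq {θ : Fin 3 → ℝ} (hθ : θ = 0 ∨ ∑ a, θ a ^ 2 = 1) :
    ∃ B : Matrix (Fin 2) (Fin 2) ℂ, qubitState θ = B.conjTranspose * B := by
  rcases hθ with rfl | hθ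
  · refine ⟨((√2 / 2 : ℝ) : ℂ) • 1, ?_⟩
    have h2 : ((√2 / 2 : ℝ) : ℂ) * ((√2 / 2 : ℝ) : ℂ) = 1 / 2 := by
      rw [← Complex.ofReal_mul]
      have : √2 / 2 * (√2 / 2) = (1 / 2 : ℝ) := by
        nlinarith [Real.sq_sqrt (show (0 : ℝ) ≤ 2 by norm_num)]
      rw [this]; norm_num
    rw [Matrix.conjTranspose_smul, Matrix.conjTranspose_one, smul_mul_smul_comm, one_mul,
      Complex.star_def, Complex.conj_ofReal, h2]
    simp [qubitState]
  · refine ⟨qubitState θ, ?_⟩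
    have hC : (θ 0 : ℂ) ^ 2 + (θ 1 : ℂ) ^ 2 + (θ 2 : ℂ) ^ 2 = 1 := by
      rw [Fin.sum_univ_three] at hθ
      exact_mod_cast hθ
    rw [qubitState_eq]
    ext a b
    fin_cases a <;> fin_cases b <;>
      simp [Matrix.mul_apply, Fin.sum_univ_two, Matrix.conjTranspose_apply,
        map_ofNat (starRingEnd ℂ) 2]
    · linear_combination (-1 / 4 : ℂ) * hC + (θ 1 : ℂ) ^ 2 / 4 * Complex.I_sq
    · ring
    · ring
    · linear_combination (-1 / 4 : ℂ) * hC + (θ 1 : ℂ) ^ 2 / 4 * Complex.I_sq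

variable {V : Type*} [Fintype V]

lemma bloch_eq_zero_or_norm (v : V → V → ℝ) (R : Fin 3 → V → ℝ) (k : V) :
    bloch v R k = 0 ∨ ∑ a, bloch v R k a ^ 2 = 1 := by
  have hn : 0 ≤ ∑ b, (∑ l, R b l * v k l) ^ 2 := Finset.sum_nonneg fun _ _ => sq_nonneg _
  rcases hn.eq_or_lt with h | h
  · left
    ext a
    simp [bloch, ← h]
  · right
    simp only [bloch, div_pow, ← Finset.sum_div, Real.sq_sqrt hn]
    exact div_self h.ne'

variable [DecidableEq V]

lemma posSemidef_matchedState (S : Finset (Sym2 V)) {θ : V → Fin 3 → ℝ}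
    (hθ : ∀ k, θ k = 0 ∨ ∑ a, θ k a ^ 2 = 1) : (matchedState S θ).PosSemidef := by
  choose u hu using exists_singletEntry_eq (V := V)
  choose B hB using fun k => exists_qubitState_eq (hθ k)
  -- on matched vertices the all-ones matrix stands for the missing one-qubit state
  let C : V → Matrix (Fin 2) (Fin 2) ℂ := fun k =>
    if k ∈ unmatched S then B k else Matrix.of fun c _ => if c = 0 then 1 else 0
  let N : Op V := Matrix.of fun c b => (∏ e ∈ S, u e b) * ∏ k, C k (c k) (b k)
  have hN : matchedState S θ = N.conjTranspose * N := by
    ext a b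
    have h1 : ∀ k, ∑ c, star (C k c (a k)) * C k c (b k) =
        if k ∈ unmatched S then qubitState (θ k) (a k) (b k) else 1 := by
      intro k
      by_cases hk : k ∈ unmatched S
      · simp only [C, hk, if_true, hB k, Matrix.mul_apply, Matrix.conjTranspose_apply]
      · simp [C, hk]
    have h2 := Finset.prod_univ_sum (fun _ : V => (Finset.univ : Finset (Fin 2)))
      (fun k c => star (C k c (a k)) * C k c (b k))
    simp only [Fintype.piFinset_univ, h1] at h2
    rw [Matrix.mul_apply]
    simp only [Matrix.conjTranspose_apply, N, Matrix.of_apply, star_mul', star_prod]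
    have h3 : ∀ c : Basis V, ((∏ e ∈ S, star (u e a)) * ∏ k, star (C k (c k) (a k))) *
        ((∏ e ∈ S, u e b) * ∏ k, C k (c k) (b k)) =
        (∏ e ∈ S, singletEntry a b e) * ∏ k, (star (C k (c k) (a k)) * C k (c k) (b k)) := by
      intro c
      simp only [hu, Finset.prod_mul_distrib]
      ring
    simp only [h3, ← Finset.mul_sum, ← h2]
    simp only [matchedState, Matrix.of_apply, mem_unmatched, Finset.prod_filter]
  rw [hN]
  exact Matrix.posSemidef_conjTranspose_mul_self N

lemma isState_matchedState {S : Finset (Sym2 V)} (hS : IsLooplessMatching S)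
    {θ : V → Fin 3 → ℝ} (hθ : ∀ k, θ k = 0 ∨ ∑ a, θ k a ^ 2 = 1) :
    IsState (matchedState S θ) :=
  ⟨posSemidef_matchedState S hθ, trace_matchedState hS θ⟩

end Positivity

/-! ### Real eigenvectors and swap expectations -/

section Eigenvector

variable {V : Type*} [DecidableEq V]

/-- The basis vector with the two qubits of an unordered pair exchanged. -/
def swapPair : Sym2 V → Basis V → Basis V :=
  Sym2.lift ⟨fun i j b => b ∘ Equiv.swap i j, fun i j => by simp only [Equiv.swap_comm i j]⟩

@[simp] lemma swapPair_mk (i j : V) (b : Basis V) : swapPair s(i, j) b = b ∘ Equiv.swap i j := rfl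

lemma comp_swap_comp_swap (i j : V) (b : Basis V) :
    (b ∘ Equiv.swap i j) ∘ Equiv.swap i j = b := by
  ext k; simp

lemma comp_swap_of_eq {i j : V} {b : Basis V} (h : b i = b j) : b ∘ Equiv.swap i j = b := by
  ext k
  simp only [Function.comp_apply]
  by_cases hi : k = i
  · subst hi; simp [h]
  by_cases hj : k = j
  · subst hj; simp [h]
  rw [Equiv.swap_apply_of_ne_of_ne hi hj]

variable [Fintype V]

lemma isHermitian_swapOp (i j : V) : (swapOp i j : Op V).IsHermitian := by
  ext a b
  have : b = a ∘ Equiv.swap i j ↔ a = b ∘ Equiv.swap i j := by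
    constructor <;> rintro rfl <;> simp [comp_swap_comp_swap]
  simp only [Matrix.conjTranspose_apply, swapOp, Matrix.of_apply, this]
  split_ifs <;> simp

lemma isHermitian_hamiltonian (G : SimpleGraph V) [DecidableRel G.Adj] (w : Sym2 V → ℝ) :
    (hamiltonian G w).IsHermitian := by
  rw [Matrix.IsHermitian, hamiltonian, Matrix.conjTranspose_sum]
  refine Finset.sum_congr rfl fun e _ => ?_
  induction e using Sym2.ind with
  | _ i j =>
  have := (isHermitian_swapOp i j).eq
  simp [edgeTerm, Matrix.conjTranspose_smul, Matrix.conjTranspose_sub, this]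

lemma edgeTerm_mulVec (e : Sym2 V) (ψ : Basis V → ℂ) (b : Basis V) :
    (edgeTerm e).mulVec ψ b = 1 / 2 * (ψ b - ψ (swapPair e b)) := by
  induction e using Sym2.ind with
  | _ i j =>
  have h : (swapOp i j).mulVec ψ b = ψ (b ∘ Equiv.swap i j) := by
    have : ∀ a, b = a ∘ Equiv.swap i j ↔ a = b ∘ Equiv.swap i j := fun a => by
      constructor <;> rintro rfl <;> simp [comp_swap_comp_swap]
    simp [Matrix.mulVec, dotProduct, swapOp, this]
  simp only [edgeTerm, Sym2.lift_mk, Matrix.smul_mulVec, Matrix.sub_mulVec, Matrix.one_mulVec,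
    Pi.smul_apply, Pi.sub_apply, h, smul_eq_mul, swapPair_mk]

lemma hamiltonian_mulVec (G : SimpleGraph V) [DecidableRel G.Adj] (w : Sym2 V → ℝ)
    (ψ : Basis V → ℂ) (b : Basis V) :
    (hamiltonian G w).mulVec ψ b =
      ∑ e ∈ G.edgeFinset, (w e : ℂ) * (1 / 2 * (ψ b - ψ (swapPair e b))) := by
  rw [hamiltonian, Matrix.sum_mulVec, Finset.sum_apply]
  refine Finset.sum_congr rfl fun e _ => ?_
  rw [Matrix.smul_mulVec, Pi.smul_apply, edgeTerm_mulVec, smul_eq_mul]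

/-- The Hamiltonian is a real matrix, so that its eigenvalues have real eigenvectors. -/
lemma exists_real_eigenvector (G : SimpleGraph V) [DecidableRel G.Adj] (w : Sym2 V → ℝ) {lam : ℝ}
    (h : lam ∈ spectrum ℝ (hamiltonian G w)) :
    ∃ ψ : Basis V → ℝ, ∑ b, ψ b ^ 2 = 1 ∧ ∀ b,
      ∑ e ∈ G.edgeFinset, w e * (1 / 2 * (ψ b - ψ (swapPair e b))) = lam * ψ b := by
  have hH := isHermitian_hamiltonian G w
  rw [hH.spectrum_real_eq_range_eigenvalues] at h
  obtain ⟨n, rfl⟩ := h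
  have hv := hH.mulVec_eigenvectorBasis n
  set u : Basis V → ℂ := ⇑(hH.eigenvectorBasis n) with hu
  have hv' : ∀ b, ∑ e ∈ G.edgeFinset, (w e : ℂ) * (1 / 2 * (u b - u (swapPair e b))) =
      (hH.eigenvalues n : ℂ) * u b := by
    intro b
    rw [← hamiltonian_mulVec, hv]
    simp
  have hne : ∃ b, u b ≠ 0 := by
    by_contra hcon
    push Not at hcon
    have h0 : hH.eigenvectorBasis n = 0 := by
      ext b; exact hcon b
    have h1 := hH.eigenvectorBasis.orthonormal.1 n
    rw [h0, norm_zero] at h1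
    exact zero_ne_one h1
  -- a nonzero real solution of the eigenvalue equation can be normalized
  have main : ∀ φ : Basis V → ℝ, (∃ b, φ b ≠ 0) →
      (∀ b, ∑ e ∈ G.edgeFinset, w e * (1 / 2 * (φ b - φ (swapPair e b))) =
        hH.eigenvalues n * φ b) →
      ∃ ψ : Basis V → ℝ, ∑ b, ψ b ^ 2 = 1 ∧ ∀ b,
        ∑ e ∈ G.edgeFinset, w e * (1 / 2 * (ψ b - ψ (swapPair e b))) =
          hH.eigenvalues n * ψ b := by
    rintro φ ⟨b₀, hb₀⟩ hφ
    have hpos : 0 < ∑ b, φ b ^ 2 :=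
      Finset.sum_pos' (fun _ _ => sq_nonneg _) ⟨b₀, Finset.mem_univ _, by positivity⟩
    refine ⟨fun b => φ b / √(∑ b, φ b ^ 2), ?_, fun b => ?_⟩
    · simp only [div_pow, Real.sq_sqrt hpos.le, ← Finset.sum_div]
      exact div_self hpos.ne'
    · rw [← mul_div_assoc, ← hφ b, Finset.sum_div]
      refine Finset.sum_congr rfl fun e _ => ?_
      ring
  obtain ⟨b₀, hb₀⟩ := hne
  by_cases hre : (u b₀).re = 0
  · refine main (fun b => (u b).im) ⟨b₀, fun him => hb₀ (Complex.ext hre him)⟩ fun b => ?_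
    have := congrArg Complex.im (hv' b)
    rw [Complex.im_sum, Complex.im_ofReal_mul] at this
    rw [← this]
    refine Finset.sum_congr rfl fun e _ => ?_
    rw [Complex.im_ofReal_mul]
    congr 1
    rw [show (1 / 2 : ℂ) = ((1 / 2 : ℝ) : ℂ) by norm_num, Complex.im_ofReal_mul, Complex.sub_im]
  · refine main (fun b => (u b).re) ⟨b₀, hre⟩ fun b => ?_
    have := congrArg Complex.re (hv' b)
    rw [Complex.re_sum, Complex.re_ofReal_mul] at this
    rw [← this]
    refine Finset.sum_congr rfl fun e _ => ?_
    rw [Complex.re_ofReal_mul]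
    congr 1
    rw [show (1 / 2 : ℂ) = ((1 / 2 : ℝ) : ℂ) by norm_num, Complex.re_ofReal_mul, Complex.sub_re]

/-- The expectation values of the swaps in the real state `ψ`. -/
def swapExpectation (ψ : Basis V → ℝ) (e : Sym2 V) : ℝ := ∑ b, ψ b * ψ (swapPair e b)

lemma relaxValue_swapExpectation (G : SimpleGraph V) [DecidableRel G.Adj] (w : Sym2 V → ℝ)
    {ψ : Basis V → ℝ} {lam : ℝ} (hψ : ∑ b, ψ b ^ 2 = 1)
    (h : ∀ b, ∑ e ∈ G.edgeFinset, w e * (1 / 2 * (ψ b - ψ (swapPair e b))) = lam * ψ b) :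
    relaxValue G w (swapExpectation ψ) = lam := by
  have h1 : ∀ e, edgeValue (swapExpectation ψ) e =
      ∑ b, ψ b * (1 / 2 * (ψ b - ψ (swapPair e b))) := by
    intro e
    simp only [edgeValue, swapExpectation]
    have h0 : 1 - ∑ b, ψ b * ψ (swapPair e b) = ∑ b, (ψ b ^ 2 - ψ b * ψ (swapPair e b)) := by
      rw [Finset.sum_sub_distrib, hψ]
    rw [h0, Finset.sum_div]
    refine Finset.sum_congr rfl fun b _ => by ring
  calc relaxValue G w (swapExpectation ψ)
      = ∑ b, ψ b * ∑ e ∈ G.edgeFinset, w e * (1 / 2 * (ψ b - ψ (swapPair e b))) := by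
        simp only [relaxValue, h1, Finset.mul_sum]
        rw [Finset.sum_comm]
        refine Finset.sum_congr rfl fun b _ => Finset.sum_congr rfl fun e _ => by ring
    _ = lam * ∑ b, ψ b ^ 2 := by
        simp only [h, Finset.mul_sum]
        refine Finset.sum_congr rfl fun b _ => by ring
    _ = lam := by rw [hψ, mul_one]

end Eigenvector

/-! ### The constraints on a triangle -/

section Triangle

variable {V : Type*} [DecidableEq V]

/-- On three qubits the antisymmetrizer `1 - A₁₂ - A₁₃ - A₂₃ + C + C⁻¹` vanishes, as two of three
bits are always equal. -/
lemma swap_add_swap_add_swap (ψ : Basis V → ℝ) {i j k : V} (hij : i ≠ j) (hik : i ≠ k)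
    (hjk : j ≠ k) (b : Basis V) :
    ψ (b ∘ Equiv.swap i j) + ψ (b ∘ Equiv.swap i k) + ψ (b ∘ Equiv.swap j k) =
      ψ b + ψ ((b ∘ Equiv.swap i j) ∘ Equiv.swap i k)
        + ψ ((b ∘ Equiv.swap i k) ∘ Equiv.swap i j) := by
  have conj : ∀ p q r : V, p ≠ q → p ≠ r → q ≠ r → (b ∘ Equiv.swap p q) ∘ Equiv.swap p r =
      (b ∘ Equiv.swap q r) ∘ Equiv.swap p q := by
    intro p q r h1 h2 h3
    ext x
    simp only [Function.comp_apply]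
    by_cases hp : x = p
    · subst hp
      simp [Equiv.swap_apply_of_ne_of_ne h2.symm h3.symm]
    by_cases hq : x = q
    · subst hq
      simp [Equiv.swap_apply_of_ne_of_ne h1.symm h3, Equiv.swap_apply_of_ne_of_ne h1 h2]
    by_cases hr : x = r
    · subst hr
      simp [Equiv.swap_apply_of_ne_of_ne h2.symm h3.symm]
    simp [Equiv.swap_apply_of_ne_of_ne hp hr, Equiv.swap_apply_of_ne_of_ne hp hq,
      Equiv.swap_apply_of_ne_of_ne hq hr]
  have hcase : b i = b j ∨ b i = b k ∨ b j = b k := by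
    generalize b i = x
    generalize b j = y
    generalize b k = z
    revert x y z
    decide
  rcases hcase with h | h | h
  · rw [conj i k j hik hij hjk.symm, comp_swap_of_eq h, Equiv.swap_comm k j]
    have : (b ∘ Equiv.swap j k) ∘ Equiv.swap i k = b ∘ Equiv.swap j k := by
      apply comp_swap_of_eq
      simp [Equiv.swap_apply_of_ne_of_ne hij hik, h]
    rw [this]
  · rw [conj i j k hij hik hjk, comp_swap_of_eq h]
    have : (b ∘ Equiv.swap j k) ∘ Equiv.swap i j = b ∘ Equiv.swap j k := by
      apply comp_swap_of_eq
      simp [Equiv.swap_apply_of_ne_of_ne hij hik, h]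
    rw [this]; ring
  · rw [conj i j k hij hik hjk, conj i k j hik hij hjk.symm, Equiv.swap_comm k j,
      comp_swap_of_eq h]
    ring

variable [Fintype V]

lemma sum_comp_swap (f : Basis V → ℝ) (i j : V) : ∑ b, f (b ∘ Equiv.swap i j) = ∑ b, f b :=
  Fintype.sum_bijective (fun b : Basis V => b ∘ Equiv.swap i j)
    (Function.Involutive.bijective fun b => comp_swap_comp_swap i j b) _ _ fun _ => rfl

/-- The Gram matrix of `ψ` and its images under the three swaps of a triangle depends only on the
expectation values of the swaps. -/
lemma sum_swap_mul_swap {ψ : Basis V → ℝ} (hψ : ∑ b, ψ b ^ 2 = 1) {i j k : V} (hij : i ≠ j)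
    (hik : i ≠ k) (hjk : j ≠ k) :
    ∑ b, ψ (b ∘ Equiv.swap i j) * ψ (b ∘ Equiv.swap i k) =
      (swapExpectation ψ s(i, j) + swapExpectation ψ s(i, k) + swapExpectation ψ s(j, k) - 1)
        / 2 := by
  have h1 : ∑ b, ψ (b ∘ Equiv.swap i j) * ψ (b ∘ Equiv.swap i k) =
      ∑ b, ψ b * ψ ((b ∘ Equiv.swap i j) ∘ Equiv.swap i k) := by
    rw [← sum_comp_swap _ i j]
    simp only [comp_swap_comp_swap]
  have h2 : ∑ b, ψ (b ∘ Equiv.swap i j) * ψ (b ∘ Equiv.swap i k) =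
      ∑ b, ψ b * ψ ((b ∘ Equiv.swap i k) ∘ Equiv.swap i j) := by
    rw [← sum_comp_swap _ i k]
    simp only [comp_swap_comp_swap]
    exact Finset.sum_congr rfl fun b _ => mul_comm _ _
  have h3 : swapExpectation ψ s(i, j) + swapExpectation ψ s(i, k) + swapExpectation ψ s(j, k) =
      1 + ∑ b, ψ b * ψ ((b ∘ Equiv.swap i j) ∘ Equiv.swap i k)
        + ∑ b, ψ b * ψ ((b ∘ Equiv.swap i k) ∘ Equiv.swap i j) := by
    simp only [swapExpectation, swapPair_mk]
    rw [← hψ, ← Finset.sum_add_distrib, ← Finset.sum_add_distrib, ← Finset.sum_add_distrib,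
      ← Finset.sum_add_distrib]
    refine Finset.sum_congr rfl fun b _ => ?_
    linear_combination ψ b * swap_add_swap_add_swap ψ hij hik hjk b
  linarith

/-- The constraints on a triangle: the Gram matrix of `ψ` and its three images is positive. -/
lemma triangle_swapExpectation {ψ : Basis V → ℝ} (hψ : ∑ b, ψ b ^ 2 = 1) {i j k : V}
    (hij : i ≠ j) (hik : i ≠ k) (hjk : j ≠ k) {x y z : ℝ}
    (hx : x = swapExpectation ψ s(i, j)) (hy : y = swapExpectation ψ s(i, k))
    (hz : z = swapExpectation ψ s(j, k)) :
    0 ≤ x + y + z ∧ x + y + z ≤ 3 ∧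
      x ^ 2 + y ^ 2 + z ^ 2 - 2 * (x * y + x * z + y * z) + 2 * (x + y + z) ≤ 3 := by
  set A : Basis V → ℝ := fun b => ψ (b ∘ Equiv.swap i j) with hA
  set B : Basis V → ℝ := fun b => ψ (b ∘ Equiv.swap i k) with hB
  set C : Basis V → ℝ := fun b => ψ (b ∘ Equiv.swap j k) with hC
  have hψA : ∑ b, ψ b * A b = x := hx.symm
  have hψB : ∑ b, ψ b * B b = y := hy.symm
  have hψC : ∑ b, ψ b * C b = z := hz.symm
  have hAA : ∑ b, A b ^ 2 = 1 := (sum_comp_swap (fun b => ψ b ^ 2) i j).trans hψ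
  have hBB : ∑ b, B b ^ 2 = 1 := (sum_comp_swap (fun b => ψ b ^ 2) i k).trans hψ
  have hCC : ∑ b, C b ^ 2 = 1 := (sum_comp_swap (fun b => ψ b ^ 2) j k).trans hψ
  have hAB : ∑ b, A b * B b = (x + y + z - 1) / 2 := by
    rw [hx, hy, hz]
    exact sum_swap_mul_swap hψ hij hik hjk
  have hAC : ∑ b, A b * C b = (x + y + z - 1) / 2 := by
    have := sum_swap_mul_swap hψ hij.symm hjk hik
    rw [Equiv.swap_comm j i, Sym2.eq_swap (a := j) (b := i), ← hx, ← hy, ← hz] at this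
    exact this.trans (by ring)
  have hBC : ∑ b, B b * C b = (x + y + z - 1) / 2 := by
    have := sum_swap_mul_swap hψ hik.symm hjk.symm hij
    rw [Equiv.swap_comm k i, Equiv.swap_comm k j, Sym2.eq_swap (a := k) (b := i),
      Sym2.eq_swap (a := k) (b := j), ← hx, ← hy, ← hz] at this
    exact this.trans (by ring)
  have expand : ∀ p q r s p' q' r' s' : ℝ,
      ∑ b, (p * ψ b + q * A b + r * B b + s * C b) *
        (p' * ψ b + q' * A b + r' * B b + s' * C b) =
      p * p' + q * q' + r * r' + s * s' + (p * q' + q * p') * x + (p * r' + r * p') * y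
        + (p * s' + s * p') * z
        + (q * r' + r * q' + q * s' + s * q' + r * s' + s * r') * ((x + y + z - 1) / 2) := by
    intro p q r s p' q' r' s'
    have : ∀ b, (p * ψ b + q * A b + r * B b + s * C b) *
        (p' * ψ b + q' * A b + r' * B b + s' * C b) =
        p * p' * ψ b ^ 2 + q * q' * A b ^ 2 + r * r' * B b ^ 2 + s * s' * C b ^ 2
        + (p * q' + q * p') * (ψ b * A b) + (p * r' + r * p') * (ψ b * B b)
        + (p * s' + s * p') * (ψ b * C b) + (q * r' + r * q') * (A b * B b)
        + (q * s' + s * q') * (A b * C b) + (r * s' + s * r') * (B b * C b) := fun b => by ring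
    simp only [this, Finset.sum_add_distrib, ← Finset.mul_sum, hψ, hψA, hψB, hψC, hAA, hBB, hCC,
      hAB, hAC, hBC]
    ring
  have nonneg : ∀ f : Basis V → ℝ, 0 ≤ ∑ b, f b * f b := fun f =>
    Finset.sum_nonneg fun b _ => mul_self_nonneg _
  have h1 := nonneg fun b => 0 * ψ b + 1 * A b + 1 * B b + 1 * C b
  have h2 := nonneg fun b => 1 * ψ b + -(1 / 3) * A b + -(1 / 3) * B b + -(1 / 3) * C b
  rw [expand] at h1 h2
  refine ⟨by linarith, by linarith, ?_⟩
  -- Cauchy-Schwarz for the part of `ψ` in the two-dimensional representation of `S₃` and the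
  -- combination of the swaps whose coefficients are the deviations from the mean
  set m := (x + y + z) / 3 with hm
  have hcs := Finset.sum_mul_sq_le_sq_mul_sq Finset.univ
    (fun b => 1 * ψ b + -(1 / 3) * A b + -(1 / 3) * B b + -(1 / 3) * C b)
    (fun b => 0 * ψ b + (x - m) * A b + (y - m) * B b + (z - m) * C b)
  simp only [pow_two (_ + _ : ℝ), expand] at hcs
  set D := (x - m) ^ 2 + (y - m) ^ 2 + (z - m) ^ 2 with hD
  have hcs' : D ^ 2 ≤ (1 - m) * (3 / 2 * (1 - m) * D) := by
    refine le_trans (le_of_eq ?_) (hcs.trans (le_of_eq ?_))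
    · rw [hD, hm]; ring
    · rw [hD, hm]; ring
  have hD0 : 0 ≤ D := by positivity
  have hfin : D ≤ 3 / 2 * (1 - m) ^ 2 := by
    rcases hD0.eq_or_lt with h0 | h0
    · rw [← h0]; positivity
    · by_contra hcon
      push Not at hcon
      linarith only [mul_lt_mul_of_pos_right hcon h0, hcs']
  rw [hD, hm] at hfin
  linarith only [hfin]

end Triangle

/-! ### Positivity of the moment matrix of a state -/

section PauliMoments

variable {V : Type*} [DecidableEq V]

/-- The basis vector with the bit at `i` flipped. -/
def flipBit (i : V) (b : Basis V) : Basis V := Function.update b i (1 - b i)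

/-- The eigenvalue of `Z` on a basis vector of a qubit. -/
def bitSign (x : Fin 2) : ℝ := if x = 0 then 1 else -1

lemma bitSign_mul_self (x : Fin 2) : bitSign x * bitSign x = 1 := by
  fin_cases x <;> simp [bitSign]

lemma flipBit_involutive (i : V) : Function.Involutive (flipBit i) := by
  intro b
  simp [flipBit]

lemma bitSign_flipBit_self (i : V) (b : Basis V) : bitSign (flipBit i b i) = - bitSign (b i) := by
  simp only [flipBit, Function.update_self]
  generalize b i = x
  fin_cases x <;> simp [bitSign]

lemma flipBit_flipBit_of_ne {i j : V} (hij : i ≠ j) {b : Basis V} (h : b i ≠ b j) :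
    flipBit j (flipBit i b) = b ∘ Equiv.swap i j := by
  have key : ∀ x y : Fin 2, x ≠ y → 1 - x = y := by decide
  ext k
  simp only [flipBit, Function.comp_apply]
  by_cases hj : k = j
  · subst hj
    simp [hij.symm, key _ _ h.symm]
  by_cases hi : k = i
  · subst hi
    simp [hj, key _ _ h]
  simp [hi, hj, Equiv.swap_apply_of_ne_of_ne hi hj]

/-- The images of `ψ` under the Pauli operators at `i`, as real vectors: `X ψ`, `i Y ψ`, `Z ψ`. -/
def pauliVector (ψ : Basis V → ℝ) : Fin 3 → V → Basis V → ℝ :=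
  ![fun i b => ψ (flipBit i b), fun i b => bitSign (b i) * ψ (flipBit i b),
    fun i b => bitSign (b i) * ψ b]

variable [Fintype V]

lemma sum_flipBit (i : V) (f : Basis V → ℝ) : ∑ b, f (flipBit i b) = ∑ b, f b :=
  Fintype.sum_bijective _ (flipBit_involutive i).bijective _ _ fun _ => rfl

/-- `X X + Y Y + Z Z = 2 SWAP - 1`, in terms of expectation values. -/
lemma sum_pauliVector_mul {ψ : Basis V → ℝ} (hψ : ∑ b, ψ b ^ 2 = 1) (i j : V) :
    ∑ p, ∑ b, pauliVector ψ p i b * pauliVector ψ p j b =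
      momentMatrix (swapExpectation ψ) i j := by
  simp only [Fin.sum_univ_three, pauliVector, momentMatrix, Matrix.of_apply, Matrix.cons_val_zero,
    Matrix.cons_val_one, Matrix.cons_val]
  by_cases hij : i = j
  · subst hij
    have h1 : ∑ b, ψ (flipBit i b) * ψ (flipBit i b) = 1 := by
      rw [sum_flipBit i fun b => ψ b * ψ b, ← hψ]
      exact Finset.sum_congr rfl fun b _ => by ring
    have h2 : ∑ b, bitSign (b i) * ψ (flipBit i b) * (bitSign (b i) * ψ (flipBit i b)) = 1 := by
      rw [← h1]
      refine Finset.sum_congr rfl fun b _ => ?_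
      linear_combination ψ (flipBit i b) * ψ (flipBit i b) * bitSign_mul_self (b i)
    have h3 : ∑ b : Basis V, bitSign (b i) * ψ b * (bitSign (b i) * ψ b) = 1 := by
      rw [← hψ]
      refine Finset.sum_congr rfl fun b _ => ?_
      linear_combination ψ b * ψ b * bitSign_mul_self (b i)
    rw [h1, h2, h3]
    norm_num
  · rw [if_neg hij]
    have h1 : ∑ b, ψ (flipBit i b) * ψ (flipBit j b)
        + ∑ b, bitSign (b i) * ψ (flipBit i b) * (bitSign (b j) * ψ (flipBit j b)) =
        ∑ b, (1 - bitSign (b i) * bitSign (b j)) * (ψ b * ψ (flipBit j (flipBit i b))) := by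
      rw [← Finset.sum_add_distrib, ← sum_flipBit i]
      refine Finset.sum_congr rfl fun b _ => ?_
      have hb : flipBit i b j = b j := by
        simp [flipBit, Ne.symm hij]
      rw [flipBit_involutive i b, bitSign_flipBit_self, hb]
      ring
    rw [h1, ← Finset.sum_add_distrib]
    have h2 : 2 * swapExpectation ψ s(i, j) - 1 =
        ∑ b, (2 * (ψ b * ψ (b ∘ Equiv.swap i j)) - ψ b ^ 2) := by
      rw [Finset.sum_sub_distrib, ← Finset.mul_sum, hψ]
      rfl
    rw [h2]
    refine Finset.sum_congr rfl fun b _ => ?_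
    by_cases h : b i = b j
    · rw [comp_swap_of_eq h, h]
      linear_combination (ψ b * ψ b - ψ b * ψ (flipBit j (flipBit i b))) * bitSign_mul_self (b j)
    · rw [flipBit_flipBit_of_ne hij h]
      have h3 : bitSign (b i) * bitSign (b j) = -1 := by
        revert h
        generalize b i = x
        generalize b j = y
        fin_cases x <;> fin_cases y <;> simp [bitSign]
      linear_combination (ψ b * ψ b - ψ b * ψ (b ∘ Equiv.swap i j)) * h3

lemma posSemidef_momentMatrix_swapExpectation {ψ : Basis V → ℝ} (hψ : ∑ b, ψ b ^ 2 = 1) :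
    (momentMatrix (swapExpectation ψ)).PosSemidef := by
  let N : Matrix (Fin 3 × Basis V) V ℝ := Matrix.of fun q i => pauliVector ψ q.1 i q.2
  have : momentMatrix (swapExpectation ψ) = N.conjTranspose * N := by
    ext i j
    rw [← sum_pauliVector_mul hψ, Matrix.mul_apply, Fintype.sum_prod_type]
    simp [N]
  rw [this]
  exact Matrix.posSemidef_conjTranspose_mul_self N

lemma isFeasible_swapExpectation {ψ : Basis V → ℝ} (hψ : ∑ b, ψ b ^ 2 = 1) :
    IsFeasible (swapExpectation ψ) := by
  refine ⟨fun i j k hij hik hjk => ?_, fun i j k hij hik hjk => ?_, fun i j k hij hik hjk => ?_,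
    posSemidef_momentMatrix_swapExpectation hψ⟩
  · linarith [(triangle_swapExpectation hψ hij hik hjk rfl rfl rfl).1]
  · linarith [(triangle_swapExpectation hψ hij hik hjk rfl rfl rfl).2.1]
  · exact (triangle_swapExpectation hψ hij hik hjk rfl rfl rfl).2.2

/-- The relaxation is an upper bound for the eigenvalues of the Hamiltonian. -/
lemma le_relaxValue_of_mem_spectrum (G : SimpleGraph V) [DecidableRel G.Adj] (w : Sym2 V → ℝ)
    {lam : ℝ} (h : lam ∈ spectrum ℝ (hamiltonian G w)) {x : Sym2 V → ℝ} (hx : IsOptimal G w x) :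
    lam ≤ relaxValue G w x := by
  obtain ⟨ψ, hψ, heig⟩ := exists_real_eigenvector G w h
  rw [← relaxValue_swapExpectation G w hψ heig]
  exact hx.2 _ (isFeasible_swapExpectation hψ)

lemma exists_isGreatest_spectrum (G : SimpleGraph V) [DecidableRel G.Adj] (w : Sym2 V → ℝ) :
    ∃ lam : ℝ, IsGreatest (spectrum ℝ (hamiltonian G w)) lam := by
  rw [(isHermitian_hamiltonian G w).spectrum_real_eq_range_eigenvalues]
  obtain ⟨n, hn⟩ := Finite.exists_max (isHermitian_hamiltonian G w).eigenvalues
  exact ⟨_, ⟨n, rfl⟩, by rintro _ ⟨m, rfl⟩; exact hn m⟩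

end PauliMoments

/-! ### Feasible points of the relaxation -/

section Feasible

variable {V : Type*} [DecidableEq V]

lemma momentMatrix_symm (x : Sym2 V → ℝ) (i j : V) : momentMatrix x i j = momentMatrix x j i := by
  simp only [momentMatrix, Matrix.of_apply, Sym2.eq_swap (a := i) (b := j), eq_comm (a := i)]

lemma isHermitian_momentMatrix (x : Sym2 V → ℝ) : (momentMatrix x).IsHermitian := by
  ext i j
  simp [momentMatrix_symm x i j]

/-- In terms of the relaxed values `y` the triangle constraints confine `(y₁, y₂, y₃)` to a cone
inside the nonnegative orthant and to `y₁ + y₂ + y₃ ≤ 3 / 2`. -/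
lemma IsFeasible.edgeValue_add_le {x : Sym2 V → ℝ} (hx : IsFeasible x) {i j k : V} (hij : i ≠ j)
    (hik : i ≠ k) (hjk : j ≠ k) : edgeValue x s(i, j) + edgeValue x s(i, k) ≤ 3 / 2 := by
  have h1 := hx.lm_nonneg i j k hij hik hjk
  have h2 := hx.lm_le i j k hij hik hjk
  have h3 := hx.pt i j k hij hik hjk
  simp only [edgeValue]
  generalize x s(i, j) = a at *
  generalize x s(i, k) = b at *
  generalize x s(j, k) = c at *
  by_contra hcon
  push Not at hcon
  nlinarith [sq_nonneg (a - b), sq_nonneg (c - 1), mul_pos (show 0 < c - 1 by linarith)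
    (show 0 < 1 - a - b by linarith)]

variable [Fintype V]

open scoped MatrixOrder Matrix.Norms.L2Operator in
lemma exists_isGram {x : Sym2 V → ℝ} (hx : IsFeasible x) :
    ∃ v, IsGram (momentMatrix x) v := by
  obtain ⟨B, hB⟩ := CStarAlgebra.nonneg_iff_eq_star_mul_self.mp hx.psd.nonneg
  refine ⟨fun i l => B l i, fun i j => ?_⟩
  rw [hB, Matrix.mul_apply]
  simp [Matrix.star_apply]

lemma IsGram.sum_sq {x : Sym2 V → ℝ} {v : V → V → ℝ} (hv : IsGram (momentMatrix x) v) (i : V) :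
    ∑ l, v i l ^ 2 = 3 := by
  have := hv i i
  simp only [momentMatrix, Matrix.of_apply, if_true] at this
  rw [this]
  exact Finset.sum_congr rfl fun l _ => by ring

lemma IsFeasible.abs_le {x : Sym2 V → ℝ} (hx : IsFeasible x) {i j : V} (hij : i ≠ j) :
    |2 * x s(i, j) - 1| ≤ 3 := by
  obtain ⟨v, hv⟩ := exists_isGram hx
  have h := hv i j
  simp only [momentMatrix, Matrix.of_apply, if_neg hij] at h
  have hcs := Finset.sum_mul_sq_le_sq_mul_sq Finset.univ (v i) (v j)
  rw [← h, hv.sum_sq, hv.sum_sq] at hcs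
  exact abs_le_of_sq_le_sq (by linarith) (by norm_num)

lemma isFeasible_one : IsFeasible fun _ : Sym2 V => (1 : ℝ) := by
  refine ⟨by intros; norm_num, by intros; norm_num, by intros; norm_num, ?_⟩
  have : momentMatrix (fun _ : Sym2 V => (1 : ℝ)) =
      (2 : ℝ) • 1 + Matrix.vecMulVec (fun _ => 1) (star fun _ => 1) := by
    ext i j
    by_cases h : i = j
    · subst h
      simp [momentMatrix, Matrix.vecMulVec_apply]; norm_num
    · simp [momentMatrix, Matrix.vecMulVec_apply, h]; norm_num
  rw [this]
  exact (Matrix.PosSemidef.one.smul (by norm_num : (0 : ℝ) ≤ 2)).add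
    (Matrix.posSemidef_vecMulVec_self_star _)

lemma isClosed_isFeasible : IsClosed {x : Sym2 V → ℝ | IsFeasible x} := by
  have hset : {x : Sym2 V → ℝ | IsFeasible x} =
      {x | ∀ i j k : V, i ≠ j → i ≠ k → j ≠ k → 0 ≤ x s(i, j) + x s(j, k) + x s(i, k)} ∩
      {x | ∀ i j k : V, i ≠ j → i ≠ k → j ≠ k → x s(i, j) + x s(j, k) + x s(i, k) ≤ 3} ∩
      {x | ∀ i j k : V, i ≠ j → i ≠ k → j ≠ k → (x s(i, j) ^ 2 + x s(i, k) ^ 2 + x s(j, k) ^ 2)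
        - 2 * (x s(i, j) * x s(i, k) + x s(i, j) * x s(j, k) + x s(i, k) * x s(j, k))
        + 2 * (x s(i, j) + x s(i, k) + x s(j, k)) ≤ 3} ∩
      {x | ∀ c : V → ℝ, 0 ≤ star c ⬝ᵥ ((momentMatrix x).mulVec c)} := by
    ext x
    simp only [Set.mem_ofPred_eq, Set.mem_inter_iff]
    constructor
    · rintro ⟨h1, h2, h3, h4⟩
      exact ⟨⟨⟨h1, h2⟩, h3⟩, fun c => h4.dotProduct_mulVec_nonneg c⟩
    · rintro ⟨⟨⟨h1, h2⟩, h3⟩, h4⟩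
      exact ⟨h1, h2, h3, .of_dotProduct_mulVec_nonneg (isHermitian_momentMatrix x) h4⟩
  rw [hset]
  have hM : ∀ i j : V, Continuous fun x : Sym2 V → ℝ => momentMatrix x i j := by
    intro i j
    by_cases h : i = j
    · simp only [momentMatrix, Matrix.of_apply, h, if_true]; fun_prop
    · simp only [momentMatrix, Matrix.of_apply, h, if_false]; fun_prop
  refine ((IsClosed.inter ?_ ?_).inter ?_).inter ?_
  · simp only [Set.ofPred_forall]
    exact isClosed_iInter fun i => isClosed_iInter fun j => isClosed_iInter fun k =>
      isClosed_iInter fun _ => isClosed_iInter fun _ => isClosed_iInter fun _ =>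
        isClosed_le (by fun_prop) (by fun_prop)
  · simp only [Set.ofPred_forall]
    exact isClosed_iInter fun i => isClosed_iInter fun j => isClosed_iInter fun k =>
      isClosed_iInter fun _ => isClosed_iInter fun _ => isClosed_iInter fun _ =>
        isClosed_le (by fun_prop) (by fun_prop)
  · simp only [Set.ofPred_forall]
    exact isClosed_iInter fun i => isClosed_iInter fun j => isClosed_iInter fun k =>
      isClosed_iInter fun _ => isClosed_iInter fun _ => isClosed_iInter fun _ =>
        isClosed_le (by fun_prop) (by fun_prop)
  · simp only [Set.ofPred_forall]
    refine isClosed_iInter fun c => isClosed_le (by fun_prop) ?_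
    simp only [dotProduct, Matrix.mulVec]
    fun_prop

/-- The diagonal coordinates are normalized to `1` to make the feasible set compact. -/
lemma exists_isOptimal (G : SimpleGraph V) [DecidableRel G.Adj] (w : Sym2 V → ℝ) :
    ∃ x, IsOptimal G w x := by
  let K : Set (Sym2 V → ℝ) := {x | IsFeasible x} ∩ ⋂ i : V, {x | x s(i, i) = 1}
  have hclosed : IsClosed K := isClosed_isFeasible.inter
    (isClosed_iInter fun i => isClosed_eq (by fun_prop) (by fun_prop))
  have hsub : K ⊆ Set.univ.pi fun _ => Set.Icc (-1 : ℝ) 2 := by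
    rintro x ⟨hx, hd⟩ e -
    induction e using Sym2.ind with
    | _ i j =>
    by_cases hij : i = j
    · subst hij
      have : x s(i, i) = 1 := Set.mem_iInter.1 hd i
      rw [this]; norm_num
    · have := abs_le.1 (hx.abs_le hij)
      constructor <;> linarith [this.1, this.2]
  have hK : IsCompact K :=
    (isCompact_univ_pi fun _ => isCompact_Icc).of_isClosed_subset hclosed hsub
  have hne : K.Nonempty := ⟨fun _ => 1, isFeasible_one, by simp⟩
  have hcont : Continuous fun x : Sym2 V → ℝ => relaxValue G w x := by
    unfold relaxValue edgeValue
    fun_prop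
  obtain ⟨x, hxK, hx⟩ := hK.exists_isMaxOn hne hcont.continuousOn
  refine ⟨x, hxK.1, fun x' hx' => ?_⟩
  classical
  let x'' : Sym2 V → ℝ := fun e => if e.IsDiag then 1 else x' e
  have hoff : ∀ i j : V, i ≠ j → x'' s(i, j) = x' s(i, j) := fun i j hij => by simp [x'', hij]
  have hmom : momentMatrix x'' = momentMatrix x' := by
    ext i j
    by_cases h : i = j
    · simp [momentMatrix, h]
    · simp [momentMatrix, h, hoff i j h]
  have hfeas : IsFeasible x'' := by
    refine ⟨fun i j k hij hik hjk => ?_, fun i j k hij hik hjk => ?_,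
      fun i j k hij hik hjk => ?_, by rw [hmom]; exact hx'.psd⟩
    · rw [hoff i j hij, hoff i k hik, hoff j k hjk]; exact hx'.lm_nonneg i j k hij hik hjk
    · rw [hoff i j hij, hoff i k hik, hoff j k hjk]; exact hx'.lm_le i j k hij hik hjk
    · rw [hoff i j hij, hoff i k hik, hoff j k hjk]; exact hx'.pt i j k hij hik hjk
  have hval : relaxValue G w x'' = relaxValue G w x' := by
    refine Finset.sum_congr rfl fun e he => ?_
    simp [edgeValue, x'', G.not_isDiag_of_mem_edgeFinset he]
  rw [← hval]
  exact hx ⟨hfeas, Set.mem_iInter.2 fun i => by simp [x'']⟩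

/-- Two edges above the threshold cannot share a vertex, since their values sum to at most
`3 / 2`. -/
lemma isLooplessMatching_highEdges (G : SimpleGraph V) [DecidableRel G.Adj] {t : ℝ}
    (ht : 3 / 4 ≤ t) {x : Sym2 V → ℝ} (hx : IsFeasible x) :
    IsLooplessMatching (highEdges G t x) := by
  have hmem : ∀ e, e ∈ highEdges G t x ↔ e ∈ G.edgeFinset ∧ t < edgeValue x e := fun e => by
    simp [highEdges]
  refine ⟨fun e he f hf k hke hkf => ?_, fun e he =>
    G.not_isDiag_of_mem_edgeFinset ((hmem e).1 he).1⟩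
  rw [hmem] at he hf
  by_contra hne
  obtain ⟨i, rfl⟩ := hke
  obtain ⟨j, rfl⟩ := hkf
  have hki : k ≠ i := by simpa using G.not_isDiag_of_mem_edgeFinset he.1
  have hkj : k ≠ j := by simpa using G.not_isDiag_of_mem_edgeFinset hf.1
  have := hx.edgeValue_add_le hki hkj (by rintro rfl; exact hne rfl)
  linarith [he.2, hf.2]

end Feasible

open MeasureTheory ProbabilityTheory Set

/-! ### Gaussian expectations with Gaussian weights -/

section Tilting

/-- A Gaussian weight turns the standard normal law into another normal law. -/
lemma integral_mul_exp_gaussianReal (φ : ℝ → ℝ) {c : ℝ} (hc : 0 ≤ c) (m σ : ℝ) :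
    ∫ g, φ g * Real.exp (-(c * (m + σ * g) ^ 2 / 2)) ∂(gaussianReal 0 1) =
      (√(1 + c * σ ^ 2))⁻¹ * Real.exp (-(c * m ^ 2 / (2 * (1 + c * σ ^ 2)))) *
        ∫ g, φ g ∂(gaussianReal (-(c * σ * m) / (1 + c * σ ^ 2))
          (Real.toNNReal (1 / (1 + c * σ ^ 2)))) := by
  have hD : 0 < 1 + c * σ ^ 2 := by positivity
  have hv : Real.toNNReal (1 / (1 + c * σ ^ 2)) ≠ 0 := by
    rw [ne_eq, Real.toNNReal_eq_zero, not_le]; positivity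
  rw [integral_gaussianReal_eq_integral_smul one_ne_zero,
    integral_gaussianReal_eq_integral_smul hv, ← integral_const_mul]
  refine integral_congr_ae (ae_of_all _ fun x => ?_)
  simp only [gaussianPDFReal, smul_eq_mul, Real.coe_toNNReal _ (show 0 ≤ 1 / (1 + c * σ ^ 2) by
    positivity), NNReal.coe_one, sub_zero, mul_one]
  have h1 : (√(2 * Real.pi * (1 / (1 + c * σ ^ 2))))⁻¹ =
      (√(2 * Real.pi))⁻¹ * √(1 + c * σ ^ 2) := by
    rw [Real.sqrt_mul (by positivity), one_div, Real.sqrt_inv, mul_inv, inv_inv]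
  have h2 : Real.exp (-x ^ 2 / 2) * Real.exp (-(c * (m + σ * x) ^ 2 / 2)) =
      Real.exp (-(c * m ^ 2 / (2 * (1 + c * σ ^ 2)))) *
        Real.exp (-(x - -(c * σ * m) / (1 + c * σ ^ 2)) ^ 2 / (2 * (1 / (1 + c * σ ^ 2)))) := by
    rw [← Real.exp_add, ← Real.exp_add]
    congr 1
    field_simp
    ring
  have h3 : (√(1 + c * σ ^ 2))⁻¹ * √(1 + c * σ ^ 2) = 1 :=
    inv_mul_cancel₀ (Real.sqrt_pos.2 hD).ne'
  rw [h1]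
  linear_combination (√(2 * Real.pi))⁻¹ * φ x * h2 - (√(2 * Real.pi))⁻¹ * φ x *
    Real.exp (-(c * m ^ 2 / (2 * (1 + c * σ ^ 2)))) *
        Real.exp (-(x - -(c * σ * m) / (1 + c * σ ^ 2)) ^ 2 / (2 * (1 / (1 + c * σ ^ 2)))) * h3

lemma integral_exp_gaussianReal {c : ℝ} (hc : 0 ≤ c) (m σ : ℝ) :
    ∫ g, Real.exp (-(c * (m + σ * g) ^ 2 / 2)) ∂(gaussianReal 0 1) =
      (√(1 + c * σ ^ 2))⁻¹ * Real.exp (-(c * m ^ 2 / (2 * (1 + c * σ ^ 2)))) := by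
  simpa using integral_mul_exp_gaussianReal (fun _ => 1) hc m σ

lemma integrable_id_gaussianReal (μ : ℝ) (v : NNReal) :
    Integrable (fun x : ℝ => x) (gaussianReal μ v) := by
  have := (memLp_id_gaussianReal (μ := μ) (v := v) 1)
  exact this.integrable (by simp)

lemma integrable_sq_gaussianReal (μ : ℝ) (v : NNReal) :
    Integrable (fun x : ℝ => x ^ 2) (gaussianReal μ v) := by
  have := (memLp_id_gaussianReal (μ := μ) (v := v) 2)
  exact MemLp.integrable_sq (f := fun x : ℝ => x) this

lemma integral_affine_mul_exp_gaussianReal {c : ℝ} (hc : 0 ≤ c) (m σ : ℝ) :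
    ∫ g, (m + σ * g) * Real.exp (-(c * (m + σ * g) ^ 2 / 2)) ∂(gaussianReal 0 1) =
      m / (1 + c * σ ^ 2) *
        ((√(1 + c * σ ^ 2))⁻¹ * Real.exp (-(c * m ^ 2 / (2 * (1 + c * σ ^ 2))))) := by
  have hD : 0 < 1 + c * σ ^ 2 := by positivity
  rw [integral_mul_exp_gaussianReal (fun g => m + σ * g) hc m σ,
    integral_add (integrable_const _) ((integrable_id_gaussianReal _ _).const_mul _),
    integral_const_mul, integral_id_gaussianReal]
  simp only [integral_const, probReal_univ, smul_eq_mul, one_mul]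
  field_simp
  ring

lemma integral_sq_mul_exp_gaussianReal {c : ℝ} (hc : 0 ≤ c) :
    ∫ g, g ^ 2 * Real.exp (-(c * g ^ 2 / 2)) ∂(gaussianReal 0 1) = (√(1 + c))⁻¹ ^ 3 := by
  have h := integral_mul_exp_gaussianReal (fun g => g ^ 2) hc 0 1
  have hD : 0 < 1 + c := by positivity
  have hvar := variance_fun_id_gaussianReal (μ := 0) (v := Real.toNNReal (1 / (1 + c)))
  rw [variance_eq_integral measurable_id'.aemeasurable, integral_id_gaussianReal] at hvar
  simp only [sub_zero] at hvar
  simp only [zero_add, one_mul, one_pow, mul_one, mul_zero, neg_zero, zero_div, hvar, ne_eq,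
    OfNat.ofNat_ne_zero, not_false_eq_true, zero_pow, Real.exp_zero] at h
  rw [h, Real.coe_toNNReal _ (by positivity)]
  have h2 : (√(1 + c))⁻¹ ^ 2 = 1 / (1 + c) := by
    rw [inv_pow, Real.sq_sqrt hD.le, one_div]
  rw [pow_succ, h2]
  ring

/-- The determinant of `1 + Σ D` for the covariance matrix `Σ` with unit diagonal and correlation
`ρ`, and `D = diag(s, c)`. -/
def tiltDet (ρ s c : ℝ) : ℝ := (1 + s) * (1 + c) - ρ ^ 2 * s * c

lemma tiltDet_factor {ρ σ s c : ℝ} (h : ρ ^ 2 + σ ^ 2 = 1) (hc : 0 ≤ c) :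
    (1 + c * σ ^ 2) * (1 + (s + c * ρ ^ 2 / (1 + c * σ ^ 2))) = tiltDet ρ s c := by
  have hD : 0 < 1 + c * σ ^ 2 := by positivity
  rw [tiltDet]
  field_simp
  linear_combination (c * (1 + s)) * h

lemma inv_sqrt_mul_inv_sqrt {ρ σ s c : ℝ} (h : ρ ^ 2 + σ ^ 2 = 1) (hc : 0 ≤ c) :
    (√(1 + c * σ ^ 2))⁻¹ * (√(1 + (s + c * ρ ^ 2 / (1 + c * σ ^ 2))))⁻¹ =
      (√(tiltDet ρ s c))⁻¹ := by
  rw [← tiltDet_factor h hc, Real.sqrt_mul (by positivity), mul_inv]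

lemma integrable_exp_prod {ρ σ s c : ℝ} (hs : 0 ≤ s) (hc : 0 ≤ c) :
    Integrable (fun p : ℝ × ℝ => Real.exp (-(s * p.1 ^ 2 / 2)) *
      Real.exp (-(c * (ρ * p.1 + σ * p.2) ^ 2 / 2)))
      ((gaussianReal 0 1).prod (gaussianReal 0 1)) := by
  refine Integrable.mono' (integrable_const 1)
    (Measurable.aestronglyMeasurable (by fun_prop)) (ae_of_all _ fun p => ?_)
  rw [← Real.exp_add, Real.norm_eq_abs, Real.abs_exp, Real.exp_le_one_iff]
  have h1 : 0 ≤ s * p.1 ^ 2 / 2 := by positivity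
  have h2 : 0 ≤ c * (ρ * p.1 + σ * p.2) ^ 2 / 2 := by positivity
  linarith

lemma integral_exp_prod {ρ σ s c : ℝ} (h : ρ ^ 2 + σ ^ 2 = 1) (hs : 0 ≤ s) (hc : 0 ≤ c) :
    ∫ p : ℝ × ℝ, Real.exp (-(s * p.1 ^ 2 / 2)) * Real.exp (-(c * (ρ * p.1 + σ * p.2) ^ 2 / 2))
      ∂((gaussianReal 0 1).prod (gaussianReal 0 1)) = (√(tiltDet ρ s c))⁻¹ := by
  rw [integral_prod _ (integrable_exp_prod hs hc)]
  simp only [integral_const_mul, integral_exp_gaussianReal hc]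
  have h1 : ∀ x : ℝ, Real.exp (-(s * x ^ 2 / 2)) *
      ((√(1 + c * σ ^ 2))⁻¹ * Real.exp (-(c * (ρ * x) ^ 2 / (2 * (1 + c * σ ^ 2))))) =
      (√(1 + c * σ ^ 2))⁻¹ *
        Real.exp (-((s + c * ρ ^ 2 / (1 + c * σ ^ 2)) * (0 + 1 * x) ^ 2 / 2)) := by
    intro x
    rw [mul_left_comm, ← Real.exp_add]
    congr 2
    have hD : 0 < 1 + c * σ ^ 2 := by positivity
    field_simp
    ring
  simp only [h1, integral_const_mul]
  rw [integral_exp_gaussianReal (by positivity)]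
  simp [inv_sqrt_mul_inv_sqrt h hc]

lemma integrable_mul_exp_prod {ρ σ s c : ℝ} (h : ρ ^ 2 + σ ^ 2 = 1) (hs : 0 ≤ s) (hc : 0 ≤ c) :
    Integrable (fun p : ℝ × ℝ => p.1 * (ρ * p.1 + σ * p.2) * (Real.exp (-(s * p.1 ^ 2 / 2)) *
      Real.exp (-(c * (ρ * p.1 + σ * p.2) ^ 2 / 2))))
      ((gaussianReal 0 1).prod (gaussianReal 0 1)) := by
  have hdom : Integrable (fun p : ℝ × ℝ => 2 * p.1 ^ 2 + p.2 ^ 2)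
      ((gaussianReal 0 1).prod (gaussianReal 0 1)) :=
    (((integrable_sq_gaussianReal 0 1).comp_fst _).const_mul 2).add
      ((integrable_sq_gaussianReal 0 1).comp_snd _)
  refine Integrable.mono' hdom
    (Measurable.aestronglyMeasurable (by fun_prop)) (ae_of_all _ fun p => ?_)
  have hexp : Real.exp (-(s * p.1 ^ 2 / 2)) *
      Real.exp (-(c * (ρ * p.1 + σ * p.2) ^ 2 / 2)) ≤ 1 := by
    rw [← Real.exp_add, Real.exp_le_one_iff]
    have h1 : 0 ≤ s * p.1 ^ 2 / 2 := by positivity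
    have h2 : 0 ≤ c * (ρ * p.1 + σ * p.2) ^ 2 / 2 := by positivity
    linarith
  rw [norm_mul, Real.norm_of_nonneg (by positivity : 0 ≤ Real.exp (-(s * p.1 ^ 2 / 2)) *
      Real.exp (-(c * (ρ * p.1 + σ * p.2) ^ 2 / 2)))]
  refine (mul_le_of_le_one_right (norm_nonneg _) hexp).trans ?_
  rw [Real.norm_eq_abs, abs_le]
  have hcs : (ρ * p.1 + σ * p.2) ^ 2 ≤ p.1 ^ 2 + p.2 ^ 2 := by
    nlinarith [sq_nonneg (ρ * p.2 - σ * p.1)]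
  constructor <;> nlinarith [sq_nonneg (p.1 + (ρ * p.1 + σ * p.2)),
    sq_nonneg (p.1 - (ρ * p.1 + σ * p.2)), sq_nonneg p.1, sq_nonneg p.2]

lemma integral_mul_exp_prod {ρ σ s c : ℝ} (h : ρ ^ 2 + σ ^ 2 = 1) (hs : 0 ≤ s) (hc : 0 ≤ c) :
    ∫ p : ℝ × ℝ, p.1 * (ρ * p.1 + σ * p.2) * (Real.exp (-(s * p.1 ^ 2 / 2)) *
      Real.exp (-(c * (ρ * p.1 + σ * p.2) ^ 2 / 2))) ∂((gaussianReal 0 1).prod (gaussianReal 0 1)) =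
        ρ * (√(tiltDet ρ s c))⁻¹ ^ 3 := by
  rw [integral_prod _ (integrable_mul_exp_prod h hs hc)]
  have h0 : ∀ x y : ℝ, x * (ρ * x + σ * y) * (Real.exp (-(s * x ^ 2 / 2)) *
      Real.exp (-(c * (ρ * x + σ * y) ^ 2 / 2))) = x * Real.exp (-(s * x ^ 2 / 2)) *
      ((ρ * x + σ * y) * Real.exp (-(c * (ρ * x + σ * y) ^ 2 / 2))) := fun x y => by ring
  simp only [h0, integral_const_mul, integral_affine_mul_exp_gaussianReal hc]
  have hD : 0 < 1 + c * σ ^ 2 := by positivity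
  have h1 : ∀ x : ℝ, x * Real.exp (-(s * x ^ 2 / 2)) * (ρ * x / (1 + c * σ ^ 2) *
      ((√(1 + c * σ ^ 2))⁻¹ * Real.exp (-(c * (ρ * x) ^ 2 / (2 * (1 + c * σ ^ 2)))))) =
      ρ * (√(1 + c * σ ^ 2))⁻¹ ^ 3 * (x ^ 2 *
        Real.exp (-((s + c * ρ ^ 2 / (1 + c * σ ^ 2)) * x ^ 2 / 2))) := by
    intro x
    have h2 : (√(1 + c * σ ^ 2))⁻¹ ^ 2 = 1 / (1 + c * σ ^ 2) := by
      rw [inv_pow, Real.sq_sqrt hD.le, one_div]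
    have h3 : Real.exp (-((s + c * ρ ^ 2 / (1 + c * σ ^ 2)) * x ^ 2 / 2)) =
        Real.exp (-(s * x ^ 2 / 2)) * Real.exp (-(c * (ρ * x) ^ 2 / (2 * (1 + c * σ ^ 2)))) := by
      rw [← Real.exp_add]
      congr 1
      field_simp
      ring
    rw [h3, pow_succ (√(1 + c * σ ^ 2))⁻¹ 2, h2]
    ring
  simp only [h1, integral_const_mul]
  rw [integral_sq_mul_exp_gaussianReal (by positivity), mul_assoc, ← mul_pow,
    inv_sqrt_mul_inv_sqrt h hc]

end Tilting

/-! ### The law of two linear functionals -/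

section PairLaw

variable {V : Type*} [Fintype V]

lemma integral_cexp_sum_mul_I_gaussianReal (c : V → ℝ) :
    ∫ r : V → ℝ, Complex.exp ((∑ l, r l * c l : ℝ) * Complex.I)
      ∂(Measure.pi fun _ => gaussianReal 0 1) = Complex.exp (-((∑ l, c l ^ 2 : ℝ) : ℂ) / 2) := by
  have h1 : ∀ r : V → ℝ, Complex.exp ((∑ l, r l * c l : ℝ) * Complex.I) =
      ∏ l, Complex.exp (c l * r l * Complex.I) := by
    intro r
    rw [← Complex.exp_sum]
    push_cast
    rw [Finset.sum_mul]
    congr 1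
    exact Finset.sum_congr rfl fun l _ => by ring
  simp only [h1]
  rw [integral_fintype_prod_eq_prod (fun l x => Complex.exp (c l * (x : ℝ) * Complex.I))]
  simp only [← charFun_apply_real, charFun_gaussianReal]
  rw [← Complex.exp_sum]
  congr 1
  push_cast
  rw [← Finset.sum_neg_distrib, Finset.sum_div]
  exact Finset.sum_congr rfl fun l _ => by simp [neg_div]

/-- The law of two linear functionals of a standard Gaussian vector depends only on the Gram matrix
of the functionals. -/
lemma map_pi_gaussianReal_pair {a b : V → ℝ} {ρ σ : ℝ} (ha : ∑ l, a l ^ 2 = 1)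
    (hb : ∑ l, b l ^ 2 = 1) (hab : ∑ l, a l * b l = ρ) (h : ρ ^ 2 + σ ^ 2 = 1) :
    (Measure.pi fun _ : V => gaussianReal 0 1).map
        (fun r => (∑ l, r l * a l, ∑ l, r l * b l)) =
      ((gaussianReal 0 1).prod (gaussianReal 0 1)).map
        (fun p : ℝ × ℝ => (p.1, ρ * p.1 + σ * p.2)) := by
  have : IsProbabilityMeasure ((Measure.pi fun _ : V => gaussianReal 0 1).map
      (fun r => (∑ l, r l * a l, ∑ l, r l * b l))) :=
    Measure.isProbabilityMeasure_map (Measurable.aemeasurable (by fun_prop))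
  have : IsProbabilityMeasure (((gaussianReal 0 1).prod (gaussianReal 0 1)).map
      (fun p : ℝ × ℝ => (p.1, ρ * p.1 + σ * p.2))) :=
    Measure.isProbabilityMeasure_map (Measurable.aemeasurable (by fun_prop))
  apply Measure.ext_of_charFunDual
  ext L
  obtain ⟨α, β, hL⟩ : ∃ α β : ℝ, ∀ x y : ℝ, L (x, y) = α * x + β * y := by
    refine ⟨L (1, 0), L (0, 1), fun x y => ?_⟩
    have : ((x, y) : ℝ × ℝ) = x • (1, 0) + y • (0, 1) := by simp
    rw [this, map_add, map_smul, map_smul, smul_eq_mul, smul_eq_mul]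
    ring
  rw [charFunDual_apply, charFunDual_apply,
    integral_map (Measurable.aemeasurable (by fun_prop))
      (Measurable.aestronglyMeasurable (by fun_prop)),
    integral_map (Measurable.aemeasurable (by fun_prop))
      (Measurable.aestronglyMeasurable (by fun_prop))]
  simp only [hL]
  have h1 : ∀ r : V → ℝ, α * ∑ l, r l * a l + β * ∑ l, r l * b l =
      ∑ l, r l * (α * a l + β * b l) := by
    intro r
    rw [Finset.mul_sum, Finset.mul_sum, ← Finset.sum_add_distrib]
    exact Finset.sum_congr rfl fun l _ => by ring
  simp only [h1, integral_cexp_sum_mul_I_gaussianReal]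
  have h2 : ∑ l, (α * a l + β * b l) ^ 2 = α ^ 2 + β ^ 2 + 2 * α * β * ρ := by
    have : ∀ l, (α * a l + β * b l) ^ 2 =
        α ^ 2 * a l ^ 2 + β ^ 2 * b l ^ 2 + 2 * α * β * (a l * b l) := fun l => by ring
    simp only [this, Finset.sum_add_distrib, ← Finset.mul_sum, ha, hb, hab]
    ring
  have h3 : ∀ p : ℝ × ℝ, Complex.exp ((α * p.1 + β * (ρ * p.1 + σ * p.2) : ℝ) * Complex.I) =
      Complex.exp ((α + β * ρ : ℝ) * (p.1 : ℝ) * Complex.I) *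
        Complex.exp ((β * σ : ℝ) * (p.2 : ℝ) * Complex.I) := by
    intro p
    rw [← Complex.exp_add]
    push_cast
    congr 1
    ring
  simp only [h3]
  rw [integral_prod_mul (fun x : ℝ => Complex.exp ((α + β * ρ : ℝ) * (x : ℝ) * Complex.I))
    (fun x : ℝ => Complex.exp ((β * σ : ℝ) * (x : ℝ) * Complex.I)), ← charFun_apply_real,
    ← charFun_apply_real, charFun_gaussianReal, charFun_gaussianReal, ← Complex.exp_add, h2]
  congr 1
  have hC : (ρ : ℂ) ^ 2 + (σ : ℂ) ^ 2 = 1 := by exact_mod_cast h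
  push_cast
  linear_combination (β : ℂ) ^ 2 / 2 * hC

end PairLaw

/-! ### Integrals over the half-line -/

section HalfLine

/-- The weight `exp (-t² n / 2)`, integrated over `t > 0`, represents `1 / √n`. -/
lemma integral_exp_neg_sq_mul {n : ℝ} (hn : 0 < n) :
    ∫ t in Ioi (0 : ℝ), Real.exp (-(t ^ 2 * n / 2)) = √(Real.pi / 2) * (√n)⁻¹ := by
  have h := integral_gaussian_Ioi (n / 2)
  have h1 : ∀ t : ℝ, Real.exp (-(t ^ 2 * n / 2)) = Real.exp (-(n / 2) * t ^ 2) := fun t => by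
    congr 1; ring
  simp only [h1, h]
  have h2 : Real.pi / (n / 2) = 2 ^ 2 * ((Real.pi / 2) * n⁻¹) := by field_simp
  rw [h2, Real.sqrt_mul (by norm_num), Real.sqrt_sq (by norm_num),
    Real.sqrt_mul (by positivity), Real.sqrt_inv]
  ring

lemma integrableOn_exp_neg_sq_mul {n : ℝ} (hn : 0 < n) :
    IntegrableOn (fun t : ℝ => Real.exp (-(t ^ 2 * n / 2))) (Ioi 0) := by
  have h1 : ∀ t : ℝ, Real.exp (-(t ^ 2 * n / 2)) = Real.exp (-(n / 2) * t ^ 2) := fun t => by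
    congr 1; ring
  simp only [h1]
  exact (integrable_exp_neg_mul_sq (by positivity)).integrableOn

lemma hasDerivAt_sqrt_add_mul_sq {A B : ℝ} (hA : 0 < A) (hB : 0 ≤ B) (t : ℝ) :
    HasDerivAt (fun t => √(A + B * t ^ 2)) (B * t / √(A + B * t ^ 2)) t := by
  have hpos : 0 < A + B * t ^ 2 := by positivity
  have h := (((hasDerivAt_pow 2 t).const_mul B).const_add A).sqrt hpos.ne'
  convert h using 1
  have := (Real.sqrt_pos.2 hpos).ne'
  field_simp
  norm_num
  ring

lemma hasDerivAt_div_sqrt {A B : ℝ} (hA : 0 < A) (hB : 0 ≤ B) (t : ℝ) :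
    HasDerivAt (fun t => t / √(A + B * t ^ 2)) (A * (√(A + B * t ^ 2))⁻¹ ^ 3) t := by
  have hpos : 0 < A + B * t ^ 2 := by positivity
  have hs := Real.sqrt_pos.2 hpos
  have hsq := Real.sq_sqrt hpos.le
  refine ((hasDerivAt_id' t).div (hasDerivAt_sqrt_add_mul_sq hA hB t) hs.ne').congr_deriv ?_
  generalize √(A + B * t ^ 2) = s at hs hsq
  field_simp
  linear_combination hsq

lemma tendsto_div_sqrt_add_mul_sq {A B : ℝ} (hA : 0 < A) (hB : 0 < B) :
    Filter.Tendsto (fun t : ℝ => t / √(A + B * t ^ 2)) Filter.atTop (nhds (√B)⁻¹) := by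
  have h1 : Filter.Tendsto (fun t : ℝ => (√(A * (t ^ 2)⁻¹ + B))⁻¹) Filter.atTop
      (nhds (√(A * 0 + B))⁻¹) := by
    refine Filter.Tendsto.inv₀ (Filter.Tendsto.sqrt ?_) ?_
    · exact ((tendsto_inv_atTop_zero.comp (Filter.tendsto_pow_atTop two_ne_zero)).const_mul A
        ).add_const B
    · rw [mul_zero, zero_add]; exact (Real.sqrt_pos.2 hB).ne'
  rw [mul_zero, zero_add] at h1
  refine h1.congr' ?_
  filter_upwards [Filter.eventually_gt_atTop 0] with t ht
  have h2 : A + B * t ^ 2 = t ^ 2 * (A * (t ^ 2)⁻¹ + B) := by field_simp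
  rw [h2, Real.sqrt_mul (by positivity), Real.sqrt_sq ht.le, div_mul_eq_div_div, div_self ht.ne',
    one_div]

/-- The integral `∫ (A + B τ²)^(-5/2) dτ`. -/
lemma integral_inv_sqrt_pow_five {A B : ℝ} (hA : 0 < A) (hB : 0 < B) :
    ∫ τ in Ioi (0 : ℝ), (√(A + B * τ ^ 2))⁻¹ ^ 5 = 2 / 3 * ((A ^ 2)⁻¹ * (√B)⁻¹) := by
  -- with `u = τ / √(A + B τ²)` a primitive is `(u - B u³ / 3) / A²`
  have hderiv : ∀ τ ∈ Ici (0 : ℝ), HasDerivAt (fun τ : ℝ => (τ / √(A + B * τ ^ 2)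
      - B * (τ / √(A + B * τ ^ 2)) ^ 3 / 3) / A ^ 2) ((√(A + B * τ ^ 2))⁻¹ ^ 5) τ := by
    intro τ _
    have hpos : 0 < A + B * τ ^ 2 := by positivity
    have hs := Real.sqrt_pos.2 hpos
    have hsq := Real.sq_sqrt hpos.le
    have hu := hasDerivAt_div_sqrt hA hB.le τ
    refine ((hu.sub (((hu.pow 3).const_mul B).div_const 3)).div_const (A ^ 2)).congr_deriv ?_
    generalize √(A + B * τ ^ 2) = s at hs hsq
    simp only [Nat.cast_ofNat, Nat.add_one_sub_one]
    field_simp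
    linear_combination hsq
  have htend : Filter.Tendsto (fun τ : ℝ => (τ / √(A + B * τ ^ 2)
      - B * (τ / √(A + B * τ ^ 2)) ^ 3 / 3) / A ^ 2) Filter.atTop
      (nhds (((√B)⁻¹ - B * (√B)⁻¹ ^ 3 / 3) / A ^ 2)) :=
    ((tendsto_div_sqrt_add_mul_sq hA hB).sub
      ((((tendsto_div_sqrt_add_mul_sq hA hB).pow 3).const_mul B).div_const 3)).div_const _
  rw [integral_Ioi_of_hasDerivAt_of_nonneg' hderiv (fun τ _ => by positivity) htend]
  have hs := Real.sqrt_pos.2 hB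
  have hsq := Real.sq_sqrt hB.le
  generalize √B = s at *
  subst hsq
  field_simp
  norm_num
  ring

end HalfLine

/-! ### The correlation of rounded Bloch vectors -/

section BlochCorrelation

variable {V : Type*} [Fintype V]

/-- The correlation of the directions of two Gaussian vectors in `ℝ³` whose coordinates have
correlation `ρ`, up to the factor `4 ρ / π`. -/
def angleIntegral (ρ : ℝ) : ℝ :=
  ∫ t in Ioi (0 : ℝ), ((1 + t ^ 2) ^ 2)⁻¹ * (√(1 + (1 - ρ ^ 2) * t ^ 2))⁻¹

lemma integral_pair {a b : V → ℝ} {ρ σ : ℝ} (ha : ∑ l, a l ^ 2 = 1)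
    (hb : ∑ l, b l ^ 2 = 1) (hab : ∑ l, a l * b l = ρ) (h : ρ ^ 2 + σ ^ 2 = 1)
    {F : ℝ × ℝ → ℝ} (hF : Measurable F) :
    ∫ r, F (∑ l, r l * a l, ∑ l, r l * b l) ∂(Measure.pi fun _ : V => gaussianReal 0 1) =
      ∫ p : ℝ × ℝ, F (p.1, ρ * p.1 + σ * p.2) ∂((gaussianReal 0 1).prod (gaussianReal 0 1)) := by
  have h1 := integral_map (μ := Measure.pi fun _ : V => gaussianReal 0 1)
    (φ := fun r => (∑ l, r l * a l, ∑ l, r l * b l)) (f := F)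
    (Measurable.aemeasurable (by fun_prop)) hF.aestronglyMeasurable
  have h2 := integral_map (μ := (gaussianReal 0 1).prod (gaussianReal 0 1))
    (φ := fun p : ℝ × ℝ => (p.1, ρ * p.1 + σ * p.2)) (f := F)
    (Measurable.aemeasurable (by fun_prop)) hF.aestronglyMeasurable
  rw [← h1, ← h2, map_pi_gaussianReal_pair ha hb hab h]

lemma integrable_pair {a b : V → ℝ} {ρ σ : ℝ} (ha : ∑ l, a l ^ 2 = 1)
    (hb : ∑ l, b l ^ 2 = 1) (hab : ∑ l, a l * b l = ρ) (h : ρ ^ 2 + σ ^ 2 = 1)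
    {F : ℝ × ℝ → ℝ} (hF : Measurable F)
    (hint : Integrable (fun p : ℝ × ℝ => F (p.1, ρ * p.1 + σ * p.2))
      ((gaussianReal 0 1).prod (gaussianReal 0 1))) :
    Integrable (fun r => F (∑ l, r l * a l, ∑ l, r l * b l))
      (Measure.pi fun _ : V => gaussianReal 0 1) := by
  have h1 := integrable_map_measure (μ := Measure.pi fun _ : V => gaussianReal 0 1)
    (f := fun r => (∑ l, r l * a l, ∑ l, r l * b l)) (g := F) hF.aestronglyMeasurable
    (Measurable.aemeasurable (by fun_prop))
  have h2 := integrable_map_measure (μ := (gaussianReal 0 1).prod (gaussianReal 0 1))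
    (f := fun p : ℝ × ℝ => (p.1, ρ * p.1 + σ * p.2)) (g := F) hF.aestronglyMeasurable
    (Measurable.aemeasurable (by fun_prop))
  rw [map_pi_gaussianReal_pair ha hb hab h] at h1
  exact h1.1 (h2.2 hint)

/-- The weighted inner product of the two Gaussian vectors in `ℝ³`: one row contributes the mixed
moment, the other two contribute the total mass of the weight. -/
lemma integral_inner_mul_exp {a b : V → ℝ} {ρ : ℝ} (ha : ∑ l, a l ^ 2 = 1)
    (hb : ∑ l, b l ^ 2 = 1) (hab : ∑ l, a l * b l = ρ) (hρ : ρ ^ 2 ≤ 1) {s c : ℝ} (hs : 0 ≤ s)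
    (hc : 0 ≤ c) :
    ∫ R, (∑ p, (∑ l, R p l * a l) * (∑ l, R p l * b l)) *
      (Real.exp (-(s * (∑ p, (∑ l, R p l * a l) ^ 2) / 2)) *
        Real.exp (-(c * (∑ p, (∑ l, R p l * b l) ^ 2) / 2))) ∂(gaussianMatrix V) =
      3 * ρ * (√(tiltDet ρ s c))⁻¹ ^ 5 := by
  have hσ : ρ ^ 2 + √(1 - ρ ^ 2) ^ 2 = 1 := by
    rw [Real.sq_sqrt (by linarith)]; ring
  let F₀ : ℝ × ℝ → ℝ := fun p => Real.exp (-(s * p.1 ^ 2 / 2)) * Real.exp (-(c * p.2 ^ 2 / 2))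
  let F₁ : ℝ × ℝ → ℝ := fun p => p.1 * p.2 * F₀ p
  have hF₀ : Measurable F₀ := by fun_prop
  have hF₁ : Measurable F₁ := by fun_prop
  let k₀ : (V → ℝ) → ℝ := fun r => F₀ (∑ l, r l * a l, ∑ l, r l * b l)
  let k₁ : (V → ℝ) → ℝ := fun r => F₁ (∑ l, r l * a l, ∑ l, r l * b l)
  have hi₀ : ∫ r, k₀ r ∂(Measure.pi fun _ : V => gaussianReal 0 1) = (√(tiltDet ρ s c))⁻¹ :=
    (integral_pair ha hb hab hσ hF₀).trans (integral_exp_prod hσ hs hc)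
  have hi₁ : ∫ r, k₁ r ∂(Measure.pi fun _ : V => gaussianReal 0 1) =
      ρ * (√(tiltDet ρ s c))⁻¹ ^ 3 :=
    (integral_pair ha hb hab hσ hF₁).trans (integral_mul_exp_prod hσ hs hc)
  have hk₀ : Integrable k₀ (Measure.pi fun _ : V => gaussianReal 0 1) :=
    integrable_pair ha hb hab hσ hF₀ (integrable_exp_prod hs hc)
  have hk₁ : Integrable k₁ (Measure.pi fun _ : V => gaussianReal 0 1) :=
    integrable_pair ha hb hab hσ hF₁ (integrable_mul_exp_prod hσ hs hc)
  have hsplit : ∀ R : Fin 3 → V → ℝ, (∑ p, (∑ l, R p l * a l) * (∑ l, R p l * b l)) *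
      (Real.exp (-(s * (∑ p, (∑ l, R p l * a l) ^ 2) / 2)) *
        Real.exp (-(c * (∑ p, (∑ l, R p l * b l) ^ 2) / 2))) =
      ∑ p, ∏ q, (if q = p then k₁ else k₀) (R q) := by
    intro R
    have he : Real.exp (-(s * (∑ p, (∑ l, R p l * a l) ^ 2) / 2)) *
        Real.exp (-(c * (∑ p, (∑ l, R p l * b l) ^ 2) / 2)) = ∏ q, k₀ (R q) := by
      simp only [k₀, F₀, Finset.prod_mul_distrib, ← Real.exp_sum, Finset.sum_neg_distrib,
        Finset.mul_sum, Finset.sum_div]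
    rw [he, Finset.sum_mul]
    refine Finset.sum_congr rfl fun p _ => ?_
    rw [← Finset.mul_prod_erase _ _ (Finset.mem_univ p),
      ← Finset.mul_prod_erase _ (fun q => (if q = p then k₁ else k₀) (R q)) (Finset.mem_univ p)]
    have : ∏ q ∈ Finset.univ.erase p, (if q = p then k₁ else k₀) (R q) =
        ∏ q ∈ Finset.univ.erase p, k₀ (R q) := by
      refine Finset.prod_congr rfl fun q hq => ?_
      rw [if_neg (Finset.ne_of_mem_erase hq)]
    rw [this, if_pos rfl]
    simp only [k₁, F₁, k₀]
    ring
  simp only [hsplit]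
  rw [integral_finsetSum]
  · have : ∀ p : Fin 3, ∫ R, ∏ q, (if q = p then k₁ else k₀) (R q) ∂(gaussianMatrix V) =
        ρ * (√(tiltDet ρ s c))⁻¹ ^ 5 := by
      intro p
      rw [gaussianMatrix, integral_fintype_prod_eq_prod
        (fun q => (if q = p then k₁ else k₀ : (V → ℝ) → ℝ)),
        ← Finset.mul_prod_erase _ _ (Finset.mem_univ p), if_pos rfl, hi₁]
      have h2 : ∏ q ∈ Finset.univ.erase p, ∫ r, (if q = p then k₁ else k₀) r
          ∂(Measure.pi fun _ : V => gaussianReal 0 1) = (√(tiltDet ρ s c))⁻¹ ^ 2 := by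
        have h3 : ∀ q ∈ Finset.univ.erase p, ∫ r, (if q = p then k₁ else k₀) r
          ∂(Measure.pi fun _ : V => gaussianReal 0 1) = (√(tiltDet ρ s c))⁻¹ := by
          intro q hq
          rw [if_neg (Finset.ne_of_mem_erase hq), hi₀]
        rw [Finset.prod_congr rfl h3, Finset.prod_const, Finset.card_erase_of_mem
          (Finset.mem_univ p)]
        simp
      rw [h2]
      ring
    simp only [this]
    simp
    ring
  · intro p _
    refine Integrable.fintype_prod (f := fun q => (if q = p then k₁ else k₀ : (V → ℝ) → ℝ))
      fun q => ?_
    by_cases hq : q = p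
    · simp only [hq, if_true]; exact hk₁
    · simp only [hq, if_false]; exact hk₀

lemma abs_sum_mul_le (x y : Fin 3 → ℝ) : |∑ p, x p * y p| ≤ √(∑ p, x p ^ 2) * √(∑ p, y p ^ 2) := by
  rw [← Real.sqrt_mul (Finset.sum_nonneg fun _ _ => sq_nonneg _), ← Real.sqrt_sq_eq_abs]
  exact Real.sqrt_le_sqrt (Finset.sum_mul_sq_le_sq_mul_sq _ _ _)

/-- The expected inner product of the directions of two correlated Gaussian vectors in `ℝ³`. -/
lemma integral_normalized_inner {a b : V → ℝ} {ρ : ℝ} (ha : ∑ l, a l ^ 2 = 1)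
    (hb : ∑ l, b l ^ 2 = 1) (hab : ∑ l, a l * b l = ρ) (hρ : ρ ^ 2 ≤ 1) :
    ∫ R, (∑ p, (∑ l, R p l * a l) * (∑ l, R p l * b l)) *
      ((√(∑ p, (∑ l, R p l * a l) ^ 2))⁻¹ * (√(∑ p, (∑ l, R p l * b l) ^ 2))⁻¹)
        ∂(gaussianMatrix V) = 4 * ρ / Real.pi * angleIntegral ρ := by
  have hprob : IsProbabilityMeasure (gaussianMatrix V) := by
    unfold gaussianMatrix; infer_instance
  let I : (Fin 3 → V → ℝ) → ℝ := fun R => ∑ p, (∑ l, R p l * a l) * (∑ l, R p l * b l)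
  let N : (Fin 3 → V → ℝ) → ℝ := fun R => ∑ p, (∑ l, R p l * a l) ^ 2
  let M : (Fin 3 → V → ℝ) → ℝ := fun R => ∑ p, (∑ l, R p l * b l) ^ 2
  have hI : Measurable I := by fun_prop
  have hN : Measurable N := by fun_prop
  have hM : Measurable M := by fun_prop
  have hN0 : ∀ R, 0 ≤ N R := fun R => Finset.sum_nonneg fun _ _ => sq_nonneg _
  have hM0 : ∀ R, 0 ≤ M R := fun R => Finset.sum_nonneg fun _ _ => sq_nonneg _
  have hIb : ∀ R, |I R| ≤ √(N R) * √(M R) := fun R => abs_sum_mul_le _ _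
  have hIz : ∀ R, N R = 0 ∨ M R = 0 → I R = 0 := by
    intro R hR
    have := hIb R
    rcases hR with h | h <;> simpa [h] using this
  let ν : Measure ℝ := volume.restrict (Ioi 0)
  let g : (Fin 3 → V → ℝ) → ℝ × ℝ → ℝ := fun R q =>
    I R * (Real.exp (-(q.1 ^ 2 * N R / 2)) * Real.exp (-(q.2 ^ 2 * M R / 2)))
  have hg : Measurable (Function.uncurry g) := by
    have : Function.uncurry g = fun z : (Fin 3 → V → ℝ) × (ℝ × ℝ) =>
      I z.1 * (Real.exp (-(z.2.1 ^ 2 * N z.1 / 2)) * Real.exp (-(z.2.2 ^ 2 * M z.1 / 2))) := rfl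
    rw [this]
    fun_prop
  have hgint : ∀ R, Integrable (g R) (ν.prod ν) := by
    intro R
    by_cases h : N R = 0 ∨ M R = 0
    · have : g R = fun _ => 0 := by
        ext q; simp [g, hIz R h]
      rw [this]; exact integrable_zero _ _ _
    · push Not at h
      exact ((integrableOn_exp_neg_sq_mul ((hN0 R).lt_of_ne' h.1)).mul_prod
        (integrableOn_exp_neg_sq_mul ((hM0 R).lt_of_ne' h.2))).const_mul _
  have hexp : ∀ R (J : ℝ), (N R = 0 ∨ M R = 0 → J = 0) →
      ∫ q : ℝ × ℝ, J * (Real.exp (-(q.1 ^ 2 * N R / 2)) * Real.exp (-(q.2 ^ 2 * M R / 2)))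
        ∂(ν.prod ν) = Real.pi / 2 * (J * ((√(N R))⁻¹ * (√(M R))⁻¹)) := by
    intro R J hJ
    by_cases h : N R = 0 ∨ M R = 0
    · simp [hJ h]
    · push Not at h
      rw [integral_const_mul, integral_prod_mul (fun t : ℝ => Real.exp (-(t ^ 2 * N R / 2)))
        (fun t : ℝ => Real.exp (-(t ^ 2 * M R / 2))),
        integral_exp_neg_sq_mul ((hN0 R).lt_of_ne' h.1),
        integral_exp_neg_sq_mul ((hM0 R).lt_of_ne' h.2)]
      linear_combination J * (√(N R))⁻¹ * (√(M R))⁻¹ *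
        Real.mul_self_sqrt (show 0 ≤ Real.pi / 2 by positivity)
  have hbound : ∀ R, |I R| * ((√(N R))⁻¹ * (√(M R))⁻¹) ≤ 1 := by
    intro R
    rw [← mul_inv, ← div_eq_mul_inv]
    exact div_le_one_of_le₀ (hIb R) (by positivity)
  have hgprod : Integrable (Function.uncurry g) ((gaussianMatrix V).prod (ν.prod ν)) := by
    rw [integrable_prod_iff hg.aestronglyMeasurable]
    refine ⟨ae_of_all _ hgint, ?_⟩
    have hnorm : ∀ R, ∫ q, ‖Function.uncurry g (R, q)‖ ∂(ν.prod ν) =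
        Real.pi / 2 * (|I R| * ((√(N R))⁻¹ * (√(M R))⁻¹)) := by
      intro R
      rw [← hexp R |I R| (fun h => by simp [hIz R h])]
      refine integral_congr_ae (ae_of_all _ fun q => ?_)
      simp only [Function.uncurry, g, norm_mul, Real.norm_eq_abs, Real.abs_exp]
    simp only [hnorm]
    refine Integrable.const_mul (Integrable.mono' (integrable_const 1)
      (Measurable.aestronglyMeasurable (by fun_prop)) (ae_of_all _ fun R => ?_)) _
    rw [Real.norm_of_nonneg (by positivity)]
    exact hbound R
  have hswap := integral_integral_swap hgprod
  have hleft : ∀ R, ∫ q, g R q ∂(ν.prod ν) =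
      Real.pi / 2 * (I R * ((√(N R))⁻¹ * (√(M R))⁻¹)) := fun R => hexp R (I R) (hIz R)
  have hright : ∀ q : ℝ × ℝ, ∫ R, g R q ∂(gaussianMatrix V) =
      3 * ρ * (√(tiltDet ρ (q.1 ^ 2) (q.2 ^ 2)))⁻¹ ^ 5 := fun q =>
    integral_inner_mul_exp ha hb hab hρ (sq_nonneg _) (sq_nonneg _)
  have hint : Integrable (fun q : ℝ × ℝ =>
      3 * ρ * (√(tiltDet ρ (q.1 ^ 2) (q.2 ^ 2)))⁻¹ ^ 5) (ν.prod ν) := by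
    have := hgprod.integral_prod_right
    simp only [Function.uncurry_apply_pair, hright] at this
    exact this
  simp only [hleft, hright] at hswap
  rw [integral_const_mul, integral_prod _ hint] at hswap
  have hinner : ∀ t : ℝ, ∫ τ, 3 * ρ * (√(tiltDet ρ (t ^ 2) (τ ^ 2)))⁻¹ ^ 5 ∂ν =
      2 * ρ * (((1 + t ^ 2) ^ 2)⁻¹ * (√(1 + (1 - ρ ^ 2) * t ^ 2))⁻¹) := by
    intro t
    have hA : 0 < 1 + t ^ 2 := by positivity
    have hB : 0 < 1 + (1 - ρ ^ 2) * t ^ 2 := by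
      have : 0 ≤ (1 - ρ ^ 2) * t ^ 2 := mul_nonneg (by linarith) (sq_nonneg _)
      linarith
    have hdet : ∀ τ : ℝ, tiltDet ρ (t ^ 2) (τ ^ 2) =
        1 + t ^ 2 + (1 + (1 - ρ ^ 2) * t ^ 2) * τ ^ 2 := fun τ => by rw [tiltDet]; ring
    simp only [hdet]
    rw [integral_const_mul, integral_inv_sqrt_pow_five hA hB]
    ring
  simp only [hinner] at hswap
  rw [integral_const_mul] at hswap
  have hpi := Real.pi_pos
  have h4 : Real.pi / 2 * ∫ R, I R * ((√(N R))⁻¹ * (√(M R))⁻¹) ∂(gaussianMatrix V) =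
    2 * ρ * angleIntegral ρ := hswap
  have h5 : ∀ E : ℝ, Real.pi / 2 * E = 2 * ρ * angleIntegral ρ →
      E = 4 * ρ / Real.pi * angleIntegral ρ := by
    intro E hE
    field_simp
    linarith
  exact h5 _ h4

end BlochCorrelation

/-! ### Bounds for the correlation integral -/

section AngleBounds

lemma integral_inv_one_add_sq_sq :
    IntegrableOn (fun t : ℝ => ((1 + t ^ 2) ^ 2)⁻¹) (Ioi 0) ∧
      ∫ t in Ioi (0 : ℝ), ((1 + t ^ 2) ^ 2)⁻¹ = Real.pi / 4 := by
  have hderiv : ∀ t ∈ Ici (0 : ℝ), HasDerivAt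
      (fun t : ℝ => (t * (1 + t ^ 2)⁻¹ + Real.arctan t) / 2) (((1 + t ^ 2) ^ 2)⁻¹) t := by
    intro t _
    have hpos : 0 < 1 + t ^ 2 := by positivity
    have h1 := ((hasDerivAt_pow 2 t).const_add 1).inv hpos.ne'
    refine ((((hasDerivAt_id' t).mul h1).add (Real.hasDerivAt_arctan t)).div_const 2
      ).congr_deriv ?_
    simp only [Nat.cast_ofNat, Nat.add_one_sub_one, Pi.inv_apply]
    field_simp
    ring
  have htend : Filter.Tendsto (fun t : ℝ => (t * (1 + t ^ 2)⁻¹ + Real.arctan t) / 2)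
      Filter.atTop (nhds ((1 * 0 + Real.pi / 2) / 2)) := by
    have h1 : Filter.Tendsto (fun t : ℝ => t * (1 + t ^ 2)⁻¹) Filter.atTop (nhds (1 * 0)) := by
      have h2 : Filter.Tendsto (fun t : ℝ => (1 - (1 + t ^ 2)⁻¹) * t⁻¹) Filter.atTop
          (nhds ((1 - 0) * 0)) := by
        refine Filter.Tendsto.mul (Filter.Tendsto.const_sub 1 ?_) tendsto_inv_atTop_zero
        exact tendsto_inv_atTop_zero.comp
          (Filter.tendsto_atTop_add_const_left _ 1 (Filter.tendsto_pow_atTop two_ne_zero))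
      rw [sub_zero] at h2
      refine h2.congr' ?_
      filter_upwards [Filter.eventually_gt_atTop 0] with t ht
      field_simp
      ring
    exact (h1.add (tendsto_nhds_of_tendsto_nhdsWithin Real.tendsto_arctan_atTop)).div_const 2
  refine ⟨integrableOn_Ioi_deriv_of_nonneg' hderiv (fun t _ => by positivity) htend, ?_⟩
  rw [integral_Ioi_of_hasDerivAt_of_nonneg' hderiv (fun t _ => by positivity) htend]
  simp
  ring

lemma one_add_mul_sq_ge_one {ρ : ℝ} (hρ : ρ ^ 2 ≤ 1) (t : ℝ) :
    1 ≤ 1 + (1 - ρ ^ 2) * t ^ 2 := by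
  have : 0 ≤ (1 - ρ ^ 2) * t ^ 2 := mul_nonneg (by linarith) (sq_nonneg _)
  linarith

lemma angleIntegrand_le {ρ : ℝ} (hρ : ρ ^ 2 ≤ 1) (t : ℝ) :
    ((1 + t ^ 2) ^ 2)⁻¹ * (√(1 + (1 - ρ ^ 2) * t ^ 2))⁻¹ ≤ ((1 + t ^ 2) ^ 2)⁻¹ := by
  refine mul_le_of_le_one_right (by positivity) (inv_le_one_of_one_le₀ ?_)
  rw [Real.one_le_sqrt]
  exact one_add_mul_sq_ge_one hρ t

lemma integrableOn_angleIntegrand {ρ : ℝ} (hρ : ρ ^ 2 ≤ 1) :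
    IntegrableOn (fun t : ℝ => ((1 + t ^ 2) ^ 2)⁻¹ * (√(1 + (1 - ρ ^ 2) * t ^ 2))⁻¹) (Ioi 0) := by
  refine Integrable.mono' integral_inv_one_add_sq_sq.1
    (Measurable.aestronglyMeasurable (by fun_prop)) (ae_of_all _ fun t => ?_)
  rw [Real.norm_of_nonneg (by positivity)]
  exact angleIntegrand_le hρ t

lemma angleIntegral_le {ρ : ℝ} (hρ : ρ ^ 2 ≤ 1) : angleIntegral ρ ≤ Real.pi / 4 := by
  rw [← integral_inv_one_add_sq_sq.2]
  exact setIntegral_mono (integrableOn_angleIntegrand hρ) integral_inv_one_add_sq_sq.1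
    (angleIntegrand_le hρ)

/-- The function `r / √(1 + (1 - r²) T)` of `r` lies above its tangent at `r = 1`. -/
lemma tangent_le_div_sqrt {r T : ℝ} (hr : 0 ≤ r) (hr1 : r ≤ 1) (hT : 0 ≤ T) :
    1 - (1 - r) * (1 + T) ≤ r * (√(1 + (1 - r ^ 2) * T))⁻¹ := by
  have hB : 1 ≤ 1 + (1 - r ^ 2) * T := by
    have : 0 ≤ (1 - r ^ 2) * T := mul_nonneg (by nlinarith) hT
    linarith
  have hs : 0 < √(1 + (1 - r ^ 2) * T) := Real.sqrt_pos.2 (by linarith)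
  by_cases h0 : 1 - (1 - r) * (1 + T) ≤ 0
  · exact h0.trans (by positivity)
  push Not at h0
  rw [← div_eq_mul_inv, le_div_iff₀ hs]
  refine abs_le_of_sq_le_sq' ?_ hr |>.2
  rw [mul_pow, Real.sq_sqrt (by linarith)]
  set s := (1 - r) * T with hsdef
  have hs0 : 0 ≤ s := mul_nonneg (by linarith) hT
  have hsr : s ≤ r := by nlinarith
  have h1 : 1 - (1 - r) * (1 + T) = r - s := by rw [hsdef]; ring
  have h2 : 1 + (1 - r ^ 2) * T = 1 + (1 + r) * s := by rw [hsdef]; ring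
  rw [h1, h2]
  -- after division by `s` the difference is convex in `s`, nonpositive at `0` and at `r`
  have h3 : r * (r ^ 2 + r - 2) + s * (1 - 2 * r - 2 * r ^ 2) + s ^ 2 * (1 + r) ≤ 0 := by
    rcases hr.eq_or_lt with h | h
    · have : s = 0 := le_antisymm (by linarith) hs0
      rw [this, ← h]; norm_num
    · nlinarith [mul_nonneg (mul_nonneg hs0 (sub_nonneg.2 hsr)) (by linarith : 0 ≤ 1 + r),
        mul_nonneg hr (sub_nonneg.2 hr1), mul_nonneg (sub_nonneg.2 hsr) (sub_nonneg.2 hr1),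
        mul_nonneg hs0 hr, mul_nonneg (mul_nonneg hs0 hr) (sub_nonneg.2 hr1),
        mul_nonneg (mul_nonneg (sub_nonneg.2 hsr) hr) (sub_nonneg.2 hr1)]
  nlinarith [mul_nonneg hs0 (neg_nonneg.2 h3)]

lemma tangent_le_mul_angleIntegral {r : ℝ} (hr : 0 ≤ r) (hr1 : r ≤ 1) :
    Real.pi / 4 - (1 - r) * (Real.pi / 2) ≤ r * angleIntegral r := by
  have hρ : r ^ 2 ≤ 1 := by nlinarith
  have hint : IntegrableOn (fun t : ℝ => (1 + t ^ 2)⁻¹) (Ioi 0) :=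
    integrable_inv_one_add_sq.integrableOn
  have h1 : ∫ t in Ioi (0 : ℝ), (((1 + t ^ 2) ^ 2)⁻¹ - (1 - r) * (1 + t ^ 2)⁻¹) =
      Real.pi / 4 - (1 - r) * (Real.pi / 2) := by
    rw [integral_sub integral_inv_one_add_sq_sq.1 (hint.const_mul _), integral_const_mul,
      integral_inv_one_add_sq_sq.2, integral_Ioi_inv_one_add_sq]
    simp
  rw [← h1, angleIntegral, ← integral_const_mul]
  refine setIntegral_mono (integral_inv_one_add_sq_sq.1.sub (hint.const_mul _))
    ((integrableOn_angleIntegrand hρ).const_mul _) fun t => ?_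
  have h2 := mul_le_mul_of_nonneg_left (tangent_le_div_sqrt hr hr1 (sq_nonneg t))
    (by positivity : 0 ≤ ((1 + t ^ 2) ^ 2)⁻¹)
  have h3 : ((1 + t ^ 2) ^ 2)⁻¹ * (1 - (1 - r) * (1 + t ^ 2)) =
      ((1 + t ^ 2) ^ 2)⁻¹ - (1 - r) * (1 + t ^ 2)⁻¹ := by
    field_simp
  simp only
  linarith

/-- The Taylor polynomial of `1 / √(1 - z)` of degree three is a lower bound. -/
lemma taylor_le_inv_sqrt {z : ℝ} (hz : 0 ≤ z) (hz1 : z < 1) :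
    1 + z / 2 + 3 / 8 * z ^ 2 + 5 / 16 * z ^ 3 ≤ (√(1 - z))⁻¹ := by
  have hs : 0 < √(1 - z) := Real.sqrt_pos.2 (by linarith)
  rw [← one_div, le_div_iff₀ hs]
  refine abs_le_of_sq_le_sq' ?_ zero_le_one |>.2
  rw [mul_pow, Real.sq_sqrt (by linarith)]
  have : 0 ≤ z ^ 4 * (35 / 64 + 14 / 64 * z + 35 / 256 * z ^ 2 + 25 / 256 * z ^ 3) := by positivity
  linarith

lemma taylor_le_angleIntegral {r : ℝ} (hr : 0 ≤ r) (hr1 : r ≤ 1) :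
    2 / 3 + r ^ 2 / 15 + 3 / 140 * r ^ 4 + 5 / 504 * r ^ 6 ≤ angleIntegral r := by
  have hρ : r ^ 2 ≤ 1 := by nlinarith
  -- in terms of `u = t / √(1 + t²)` the integral is `∫ (1 - u²) / √(1 - r² u²) du`
  let Q : ℝ → ℝ := fun u => (u - u ^ 3 / 3) + r ^ 2 / 2 * (u ^ 3 / 3 - u ^ 5 / 5)
    + 3 / 8 * r ^ 4 * (u ^ 5 / 5 - u ^ 7 / 7) + 5 / 16 * r ^ 6 * (u ^ 7 / 7 - u ^ 9 / 9)
  let q : ℝ → ℝ := fun u => (1 - u ^ 2) *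
    (1 + r ^ 2 * u ^ 2 / 2 + 3 / 8 * (r ^ 2 * u ^ 2) ^ 2 + 5 / 16 * (r ^ 2 * u ^ 2) ^ 3)
  have hQ : ∀ u, HasDerivAt Q (q u) u := by
    intro u
    have hp : ∀ n : ℕ, HasDerivAt (fun u : ℝ => u ^ (n + 1) / ((n + 1 : ℕ) : ℝ)) (u ^ n) u := by
      intro n
      refine ((hasDerivAt_pow (n + 1) u).div_const _).congr_deriv ?_
      have : ((n + 1 : ℕ) : ℝ) ≠ 0 := by positivity
      field_simp
      simp
    have h3 := hp 2
    have h5 := hp 4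
    have h7 := hp 6
    have h9 := hp 8
    refine (((((hasDerivAt_id' u).sub h3).add ((h3.sub h5).const_mul (r ^ 2 / 2))).add
      ((h5.sub h7).const_mul (3 / 8 * r ^ 4))).add
      ((h7.sub h9).const_mul (5 / 16 * r ^ 6))).congr_deriv ?_
    simp only [q]
    ring
  let u : ℝ → ℝ := fun t => t / √(1 + 1 * t ^ 2)
  have hu2 : ∀ t, u t ^ 2 = t ^ 2 / (1 + t ^ 2) := by
    intro t
    simp only [u, one_mul, div_pow]
    rw [Real.sq_sqrt (by positivity)]
  have hu1 : ∀ t, u t ^ 2 < 1 := by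
    intro t
    rw [hu2, div_lt_one (by positivity)]
    linarith
  have hq0 : ∀ t, 0 ≤ q (u t) := by
    intro t
    have := hu1 t
    exact mul_nonneg (by linarith) (by positivity)
  have hderiv : ∀ t ∈ Ici (0 : ℝ), HasDerivAt (fun t => Q (u t))
      (q (u t) * (√(1 + 1 * t ^ 2))⁻¹ ^ 3) t := by
    intro t _
    refine ((hQ (u t)).comp t (hasDerivAt_div_sqrt one_pos zero_le_one t)).congr_deriv ?_
    rw [one_mul]
  have htend : Filter.Tendsto (fun t => Q (u t)) Filter.atTop (nhds (Q 1)) := by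
    have h1 := tendsto_div_sqrt_add_mul_sq one_pos (one_pos : (0 : ℝ) < 1)
    rw [Real.sqrt_one, inv_one] at h1
    exact ((hQ 1).continuousAt.tendsto).comp h1
  have hpos : ∀ t ∈ Ioi (0 : ℝ), 0 ≤ q (u t) * (√(1 + 1 * t ^ 2))⁻¹ ^ 3 := fun t _ =>
    mul_nonneg (hq0 t) (by positivity)
  have hval := integral_Ioi_of_hasDerivAt_of_nonneg' hderiv hpos htend
  have hQ1 : Q 1 - Q (u 0) = 2 / 3 + r ^ 2 / 15 + 3 / 140 * r ^ 4 + 5 / 504 * r ^ 6 := by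
    simp only [Q, u, zero_div]
    ring
  rw [hQ1] at hval
  rw [← hval, angleIntegral]
  refine setIntegral_mono (integrableOn_Ioi_deriv_of_nonneg' hderiv hpos htend)
    (integrableOn_angleIntegrand hρ) fun t => ?_
  have hA : 0 < 1 + t ^ 2 := by positivity
  have hz1 : r ^ 2 * u t ^ 2 < 1 := by nlinarith [hu1 t, sq_nonneg (u t)]
  have htay := taylor_le_inv_sqrt (by positivity : 0 ≤ r ^ 2 * u t ^ 2) hz1
  have hB : 1 + (1 - r ^ 2) * t ^ 2 = (1 + t ^ 2) * (1 - r ^ 2 * u t ^ 2) := by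
    rw [hu2]; field_simp; ring
  have h1u : 1 - u t ^ 2 = (1 + t ^ 2)⁻¹ := by
    rw [hu2]; field_simp; ring
  have hs3 : (√(1 + 1 * t ^ 2))⁻¹ ^ 3 = (1 + t ^ 2)⁻¹ * (√(1 + t ^ 2))⁻¹ := by
    rw [one_mul, pow_succ, inv_pow, Real.sq_sqrt hA.le]
  simp only [q]
  rw [hB, Real.sqrt_mul hA.le, hs3, h1u]
  have h4 := mul_le_mul_of_nonneg_left htay
    (by positivity : 0 ≤ ((1 + t ^ 2) ^ 2)⁻¹ * (√(1 + t ^ 2))⁻¹)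
  calc _ = ((1 + t ^ 2) ^ 2)⁻¹ * (√(1 + t ^ 2))⁻¹ * (1 + r ^ 2 * u t ^ 2 / 2
        + 3 / 8 * (r ^ 2 * u t ^ 2) ^ 2 + 5 / 16 * (r ^ 2 * u t ^ 2) ^ 3) := by
        rw [← inv_pow]; ring
    _ ≤ _ := h4
    _ = _ := by rw [mul_inv]; ring

end AngleBounds

/-! ### Approximation ratios of single edges -/

section Numerics

/-- The expected inner product of two rounded Bloch vectors whose Gaussian vectors have correlation
`ρ`. -/
def blochCorrelation (ρ : ℝ) : ℝ := 4 * ρ / Real.pi * angleIntegral ρ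

lemma blochCorrelation_le {ρ : ℝ} (h0 : 0 ≤ ρ) (h1 : ρ ≤ 1) : blochCorrelation ρ ≤ ρ := by
  have hpi := Real.pi_pos
  have h := mul_le_mul_of_nonneg_left (angleIntegral_le (show ρ ^ 2 ≤ 1 by nlinarith))
    (by positivity : 0 ≤ 4 * ρ / Real.pi)
  refine h.trans (le_of_eq ?_)
  field_simp

lemma blochCorrelation_neg (r : ℝ) :
    blochCorrelation (-r) = -(4 / Real.pi * (r * angleIntegral r)) := by
  simp only [blochCorrelation, angleIntegral, neg_sq]
  ring

lemma blochCorrelation_neg_le_tangent {r : ℝ} (h0 : 0 ≤ r) (h1 : r ≤ 1) :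
    blochCorrelation (-r) ≤ 1 - 2 * r := by
  have hpi := Real.pi_pos
  have h := mul_le_mul_of_nonneg_left (tangent_le_mul_angleIntegral h0 h1)
    (by positivity : 0 ≤ 4 / Real.pi)
  rw [blochCorrelation_neg]
  have h2 : 4 / Real.pi * (Real.pi / 4 - (1 - r) * (Real.pi / 2)) = 2 * r - 1 := by
    field_simp; ring
  linarith

lemma blochCorrelation_neg_le_taylor {r : ℝ} (h0 : 0 ≤ r) (h1 : r ≤ 1) :
    blochCorrelation (-r) ≤
      -(0.84882 * (r + r ^ 3 / 10 + 9 / 280 * r ^ 5 + 5 / 336 * r ^ 7)) := by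
  have hpi := Real.pi_pos
  have hpi' := Real.pi_lt_d4
  rw [blochCorrelation_neg]
  have hc : (0.84882 : ℝ) ≤ 4 / Real.pi * (2 / 3) := by
    rw [div_mul_eq_mul_div, le_div_iff₀ hpi]
    linarith
  have h := mul_le_mul_of_nonneg_left (taylor_le_angleIntegral h0 h1)
    (by positivity : 0 ≤ 4 / Real.pi * r)
  have h2 := mul_le_mul_of_nonneg_right hc
    (by positivity : 0 ≤ r + r ^ 3 / 10 + 9 / 280 * r ^ 5 + 5 / 336 * r ^ 7)
  have h3 : 4 / Real.pi * r * (2 / 3 + r ^ 2 / 15 + 3 / 140 * r ^ 4 + 5 / 504 * r ^ 6) =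
      4 / Real.pi * (2 / 3) * (r + r ^ 3 / 10 + 9 / 280 * r ^ 5 + 5 / 336 * r ^ 7) := by ring
  rw [h3] at h
  linarith

/-- The tangent of a power at `a` is a lower bound. -/
lemma tangent_le_pow {a r : ℝ} (ha : 0 < a) (hr : 0 ≤ r) (n : ℕ) :
    a ^ n * (1 + n * (r / a - 1)) ≤ r ^ n := by
  have h := one_add_mul_le_pow (a := r / a - 1)
    (by have : 0 ≤ r / a := by positivity
        linarith) n
  rw [add_sub_cancel, div_pow] at h
  have h2 := mul_le_mul_of_nonneg_left h (by positivity : 0 ≤ a ^ n)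
  rwa [mul_div_cancel₀ _ (by positivity)] at h2

/-- Below the threshold the product state alone achieves the ratio `0.526`. -/
lemma productRatio_of_le {y : ℝ} (h0 : -1 / 2 ≤ y) (h1 : y ≤ 0.771) :
    0.526 * y ≤ (1 - blochCorrelation ((1 - 4 * y) / 3)) / 4 := by
  by_cases hy : y ≤ 1 / 4
  · have := blochCorrelation_le (show 0 ≤ (1 - 4 * y) / 3 by linarith) (by linarith)
    linarith
  · push Not at hy
    obtain ⟨r, hr⟩ : ∃ r, r = (4 * y - 1) / 3 := ⟨_, rfl⟩
    have hy' : y = (1 + 3 * r) / 4 := by rw [hr]; ring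
    subst hy'
    have hr0 : 0 ≤ r := by linarith
    have h := blochCorrelation_neg_le_taylor hr0 (by linarith)
    have he : (1 - 4 * ((1 + 3 * r) / 4)) / 3 = -r := by ring
    rw [he]
    -- the slack is smallest at the upper end of the range, and tangents there suffice
    have h3 := tangent_le_pow (show (0 : ℝ) < 0.6947 by norm_num) hr0 3
    have h5 := tangent_le_pow (show (0 : ℝ) < 0.6947 by norm_num) hr0 5
    have h7 := tangent_le_pow (show (0 : ℝ) < 0.6947 by norm_num) hr0 7
    norm_num at h3 h5 h7 h1 ⊢
    linarith

/-- A pair that meets the matching without being in it has relaxed value below `0.729`; the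
maximally mixed state, used with weight `0.059`, does not spoil the ratio. -/
lemma adjacentRatio_of_le {y : ℝ} (h0 : -1 / 2 ≤ y) (h1 : y ≤ 0.729) :
    0.526 * y ≤
      0.059 * (1 / 4) + 0.941 * ((1 - blochCorrelation ((1 - 4 * y) / 3)) / 4) := by
  by_cases hy : y ≤ 1 / 4
  · have := blochCorrelation_le (show 0 ≤ (1 - 4 * y) / 3 by linarith) (by linarith)
    linarith
  · push Not at hy
    obtain ⟨r, hr⟩ : ∃ r, r = (4 * y - 1) / 3 := ⟨_, rfl⟩
    have hy' : y = (1 + 3 * r) / 4 := by rw [hr]; ring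
    subst hy'
    have hr0 : 0 ≤ r := by linarith
    have h := blochCorrelation_neg_le_taylor hr0 (by linarith)
    have he : (1 - 4 * ((1 + 3 * r) / 4)) / 3 = -r := by ring
    rw [he]
    -- the slack is smallest at the upper end of the range, and tangents there suffice
    have h3 := tangent_le_pow (show (0 : ℝ) < 0.6387 by norm_num) hr0 3
    have h5 := tangent_le_pow (show (0 : ℝ) < 0.6387 by norm_num) hr0 5
    have h7 := tangent_le_pow (show (0 : ℝ) < 0.6387 by norm_num) hr0 7
    norm_num at h3 h5 h7 h1 ⊢
    linarith

/-- On the matching, the singlet with weight `0.059` compensates the poor ratio of the product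
state. -/
lemma matchedRatio_of_ge {y : ℝ} (h0 : 0.771 ≤ y) (h1 : y ≤ 1) :
    0.526 * y ≤ 0.059 * 1 + 0.941 * ((1 - blochCorrelation ((1 - 4 * y) / 3)) / 4) := by
  obtain ⟨r, hr⟩ : ∃ r, r = (4 * y - 1) / 3 := ⟨_, rfl⟩
  have hy' : y = (1 + 3 * r) / 4 := by rw [hr]; ring
  subst hy'
  have hr0 : 0 ≤ r := by linarith
  have he : (1 - 4 * ((1 + 3 * r) / 4)) / 3 = -r := by ring
  rw [he]
  -- the bound `1 - 2 r` suffices for `r` close to `1`, the Taylor polynomial up to `0.954`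
  by_cases hc : r ≤ 0.954
  · have h := blochCorrelation_neg_le_taylor hr0 (by linarith)
    have h3 := tangent_le_pow (show (0 : ℝ) < 0.954 by norm_num) hr0 3
    have h5 := tangent_le_pow (show (0 : ℝ) < 0.954 by norm_num) hr0 5
    have h7 := tangent_le_pow (show (0 : ℝ) < 0.954 by norm_num) hr0 7
    norm_num at h3 h5 h7 hc ⊢
    linarith
  · push Not at hc
    have h := blochCorrelation_neg_le_tangent hr0 (by linarith)
    norm_num at hc ⊢
    linarith

end Numerics

/-! ### The expected value of the algorithm -/

section Rounding

variable {V : Type*} [Fintype V]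

instance isProbabilityMeasure_gaussianMatrix : IsProbabilityMeasure (gaussianMatrix V) := by
  unfold gaussianMatrix; infer_instance

lemma measurable_bloch (v : V → V → ℝ) (k : V) (a : Fin 3) :
    Measurable fun R => bloch v R k a := by
  unfold bloch
  fun_prop

lemma measurable_productValue (v : V → V → ℝ) (e : Sym2 V) :
    Measurable fun R => productValue (bloch v R) e := by
  induction e using Sym2.ind with
  | _ i j =>
  simp only [productValue, Sym2.lift_mk]
  have := measurable_bloch v
  fun_prop

lemma abs_productValue_le (v : V → V → ℝ) (R : Fin 3 → V → ℝ) (e : Sym2 V) :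
    |productValue (bloch v R) e| ≤ 1 := by
  induction e using Sym2.ind with
  | _ i j =>
  have hle : ∀ k, ∑ a, bloch v R k a ^ 2 ≤ 1 := by
    intro k
    rcases bloch_eq_zero_or_norm v R k with h | h
    · simp [h]
    · exact h.le
  have h1 := abs_sum_mul_le (bloch v R i) (bloch v R j)
  have h2 : √(∑ a, bloch v R i a ^ 2) * √(∑ a, bloch v R j a ^ 2) ≤ 1 :=
    mul_le_one₀ (Real.sqrt_le_one.2 (hle i)) (Real.sqrt_nonneg _) (Real.sqrt_le_one.2 (hle j))
  have h3 := abs_le.1 (h1.trans h2)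
  simp only [productValue, Sym2.lift_mk]
  rw [abs_le]
  constructor <;> linarith [h3.1, h3.2]

lemma integrable_productValue (v : V → V → ℝ) (e : Sym2 V) :
    Integrable (fun R => productValue (bloch v R) e) (gaussianMatrix V) :=
  Integrable.mono' (integrable_const 1) (measurable_productValue v e).aestronglyMeasurable
    (ae_of_all _ fun R => abs_productValue_le v R e)

variable [DecidableEq V]

lemma integrable_matchedValue (S : Finset (Sym2 V)) (v : V → V → ℝ) (e : Sym2 V) :
    Integrable (fun R => matchedValue S (bloch v R) e) (gaussianMatrix V) := by
  unfold matchedValue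
  split_ifs
  · exact integrable_const _
  · exact integrable_productValue v e
  · exact integrable_const _

/-- The vectors `v i / √3` are unit vectors with the same rounding. -/
lemma integral_productValue {x : Sym2 V → ℝ} (hx : IsFeasible x) {v : V → V → ℝ}
    (hv : IsGram (momentMatrix x) v) {e : Sym2 V} (he : ¬ e.IsDiag) :
    ∫ R, productValue (bloch v R) e ∂(gaussianMatrix V) =
      (1 - blochCorrelation ((1 - 4 * edgeValue x e) / 3)) / 4 := by
  induction e using Sym2.ind with
  | _ i j =>
  have hij : i ≠ j := by simpa using he
  have h3 : (0 : ℝ) < √3 := by positivity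
  have h3sq : √3 ^ 2 = (3 : ℝ) := Real.sq_sqrt (by norm_num)
  have hunit : ∀ k, ∑ l, (v k l / √3) ^ 2 = 1 := by
    intro k
    simp only [div_pow, ← Finset.sum_div, h3sq, hv.sum_sq k]
    norm_num
  have hij' := hv i j
  simp only [momentMatrix, Matrix.of_apply, if_neg hij] at hij'
  have hab : ∑ l, v i l / √3 * (v j l / √3) = (1 - 4 * edgeValue x s(i, j)) / 3 := by
    have : ∀ l, v i l / √3 * (v j l / √3) = v i l * v j l / 3 := by
      intro l
      rw [div_mul_div_comm, ← sq, h3sq]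
    simp only [this, ← Finset.sum_div, ← hij', edgeValue]
    ring
  have hρ : ((1 - 4 * edgeValue x s(i, j)) / 3) ^ 2 ≤ 1 := by
    have h := abs_le.1 (hx.abs_le hij)
    rw [sq_le_one_iff_abs_le_one, abs_le, edgeValue]
    constructor <;> linarith [h.1, h.2]
  have hmain := integral_normalized_inner (hunit i) (hunit j) hab hρ
  have hbloch : ∀ (R : Fin 3 → V → ℝ) (k : V) (a : Fin 3), bloch v R k a =
      (∑ l, R a l * (v k l / √3)) * (√(∑ p, (∑ l, R p l * (v k l / √3)) ^ 2))⁻¹ := by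
    intro R k a
    simp only [bloch, ← mul_div_assoc, ← Finset.sum_div, div_pow]
    rw [Real.sqrt_div' _ (by positivity), Real.sqrt_sq h3.le]
    field_simp
  have hval : ∀ R, productValue (bloch v R) s(i, j) =
      (1 - (∑ p, (∑ l, R p l * (v i l / √3)) * (∑ l, R p l * (v j l / √3))) *
        ((√(∑ p, (∑ l, R p l * (v i l / √3)) ^ 2))⁻¹ *
          (√(∑ p, (∑ l, R p l * (v j l / √3)) ^ 2))⁻¹)) / 4 := by
    intro R
    simp only [productValue, Sym2.lift_mk, hbloch]
    rw [Finset.sum_mul]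
    congr 2
    exact Finset.sum_congr rfl fun p _ => by ring
  have hint : Integrable (fun R : Fin 3 → V → ℝ =>
      (∑ p, (∑ l, R p l * (v i l / √3)) * (∑ l, R p l * (v j l / √3))) *
        ((√(∑ p, (∑ l, R p l * (v i l / √3)) ^ 2))⁻¹ *
          (√(∑ p, (∑ l, R p l * (v j l / √3)) ^ 2))⁻¹)) (gaussianMatrix V) := by
    have h4 := ((integrable_productValue v s(i, j)).const_mul (-4)).add (integrable_const 1)
    refine h4.congr (ae_of_all _ fun R => ?_)
    simp only [Pi.add_apply, hval]
    ring
  simp only [hval]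
  rw [integral_div, integral_sub (integrable_const _) hint, hmain]
  simp [blochCorrelation]

lemma edgeValue_mem {x : Sym2 V → ℝ} (hx : IsFeasible x) {e : Sym2 V} (he : ¬ e.IsDiag) :
    -1 / 2 ≤ edgeValue x e ∧ edgeValue x e ≤ 1 := by
  induction e using Sym2.ind with
  | _ i j =>
  have h := abs_le.1 (hx.abs_le (i := i) (j := j) (by simpa using he))
  rw [edgeValue]
  constructor <;> linarith [h.1, h.2]

/-- The convex combination of the two expected energies with weights `0.059` and `0.941` has the
ratio `0.526` on every edge. The weight `0.059` lies in the narrow range which is large enough for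
the edges of the matching and small enough for the edges that meet it. -/
lemma ratio_le_edge (G : SimpleGraph V) [DecidableRel G.Adj] {x : Sym2 V → ℝ} (hx : IsFeasible x)
    {v : V → V → ℝ} (hv : IsGram (momentMatrix x) v) {e : Sym2 V} (he : e ∈ G.edgeFinset) :
    0.526 * edgeValue x e ≤
      0.059 * ∫ R, matchedValue (highEdges G 0.771 x) (bloch v R) e ∂(gaussianMatrix V) +
      0.941 * ∫ R, productValue (bloch v R) e ∂(gaussianMatrix V) := by
  have hd := G.not_isDiag_of_mem_edgeFinset he
  have hmem : ∀ f, f ∈ highEdges G 0.771 x ↔ f ∈ G.edgeFinset ∧ 0.771 < edgeValue x f :=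
    fun f => by simp [highEdges]
  have hr := edgeValue_mem hx hd
  rw [integral_productValue hx hv hd]
  by_cases h1 : e ∈ highEdges G 0.771 x
  · simp only [matchedValue, if_pos h1]
    rw [integral_const, probReal_univ, smul_eq_mul, one_mul]
    exact matchedRatio_of_ge ((hmem e).1 h1).2.le hr.2
  have hlow : edgeValue x e ≤ 0.771 := not_lt.1 fun h => h1 ((hmem e).2 ⟨he, h⟩)
  by_cases h2 : e.toFinset ⊆ unmatched (highEdges G 0.771 x)
  · simp only [matchedValue, if_neg h1, if_pos h2]
    rw [integral_productValue hx hv hd]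
    have := productRatio_of_le hr.1 hlow
    norm_num at this ⊢
    linarith
  · simp only [matchedValue, if_neg h1, if_neg h2]
    rw [integral_const, probReal_univ, smul_eq_mul, one_mul]
    refine adjacentRatio_of_le hr.1 ?_
    rw [Finset.not_subset] at h2
    obtain ⟨k, hk, hkS⟩ := h2
    rw [mem_unmatched] at hkS
    push Not at hkS
    obtain ⟨f, hf, hkf⟩ := hkS
    rw [Sym2.mem_toFinset] at hk
    have hf' := (hmem f).1 hf
    obtain ⟨i, rfl⟩ := hk
    obtain ⟨j, rfl⟩ := hkf
    have hki : k ≠ i := by simpa using hd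
    have hkj : k ≠ j := by simpa using G.not_isDiag_of_mem_edgeFinset hf'.1
    have := hx.edgeValue_add_le hki hkj (by rintro rfl; exact h1 hf)
    have := hf'.2
    norm_num at this ⊢
    linarith

lemma algorithmValue_eq (G : SimpleGraph V) [DecidableRel G.Adj] (w : Sym2 V → ℝ)
    {x : Sym2 V → ℝ} (hx : IsFeasible x) (v : V → V → ℝ) :
    algorithmValue G w 0.771 x v = fun R => max
      (∑ e ∈ G.edgeFinset, w e * matchedValue (highEdges G 0.771 x) (bloch v R) e)
      (∑ e ∈ G.edgeFinset, w e * productValue (bloch v R) e) := by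
  ext R
  rw [algorithmValue, energy_productState, energy_matchedState G w
    (isLooplessMatching_highEdges G (by norm_num) hx)]

lemma integrable_algorithmValue (G : SimpleGraph V) [DecidableRel G.Adj] (w : Sym2 V → ℝ)
    {x : Sym2 V → ℝ} (hx : IsFeasible x) (v : V → V → ℝ) :
    Integrable (algorithmValue G w 0.771 x v) (gaussianMatrix V) := by
  rw [algorithmValue_eq G w hx v]
  exact (integrable_finsetSum _ fun e _ => (integrable_matchedValue _ v e).const_mul _).sup
    (integrable_finsetSum _ fun e _ => (integrable_productValue v e).const_mul _)

lemma ratio_le_integral_algorithmValue (G : SimpleGraph V) [DecidableRel G.Adj] (w : Sym2 V → ℝ)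
    (hw : ∀ e ∈ G.edgeSet, 0 ≤ w e) {x : Sym2 V → ℝ} (hx : IsFeasible x) {v : V → V → ℝ}
    (hv : IsGram (momentMatrix x) v) :
    0.526 * relaxValue G w x ≤ ∫ R, algorithmValue G w 0.771 x v R ∂(gaussianMatrix V) := by
  have hi₁ : ∀ e, Integrable (fun R => w e * matchedValue (highEdges G 0.771 x) (bloch v R) e)
      (gaussianMatrix V) := fun e => (integrable_matchedValue _ v e).const_mul _
  have hi₂ : ∀ e, Integrable (fun R => w e * productValue (bloch v R) e)
      (gaussianMatrix V) := fun e => (integrable_productValue v e).const_mul _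
  have hs₁ := integrable_finsetSum G.edgeFinset fun e _ => hi₁ e
  have hs₂ := integrable_finsetSum G.edgeFinset fun e _ => hi₂ e
  calc 0.526 * relaxValue G w x
      ≤ 0.059 * ∑ e ∈ G.edgeFinset, w e *
            ∫ R, matchedValue (highEdges G 0.771 x) (bloch v R) e ∂(gaussianMatrix V)
          + 0.941 * ∑ e ∈ G.edgeFinset, w e *
            ∫ R, productValue (bloch v R) e ∂(gaussianMatrix V) := by
        rw [relaxValue, Finset.mul_sum, Finset.mul_sum, Finset.mul_sum, ← Finset.sum_add_distrib]
        refine Finset.sum_le_sum fun e he => ?_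
        have := mul_le_mul_of_nonneg_left (ratio_le_edge G hx hv he)
          (hw e (SimpleGraph.mem_edgeFinset.1 he))
        linarith
    _ = ∫ R, (0.059 * ∑ e ∈ G.edgeFinset, w e *
            matchedValue (highEdges G 0.771 x) (bloch v R) e
          + 0.941 * ∑ e ∈ G.edgeFinset, w e * productValue (bloch v R) e)
            ∂(gaussianMatrix V) := by
        rw [integral_add (hs₁.const_mul _) (hs₂.const_mul _), integral_const_mul,
          integral_const_mul, integral_finsetSum _ fun e _ => hi₁ e,
          integral_finsetSum _ fun e _ => hi₂ e]
        simp only [integral_const_mul]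
    _ ≤ _ := by
        refine integral_mono ((hs₁.const_mul _).add (hs₂.const_mul _))
          (integrable_algorithmValue G w hx v) fun R => ?_
        rw [algorithmValue_eq G w hx v]
        simp only
        set α := ∑ e ∈ G.edgeFinset, w e * matchedValue (highEdges G 0.771 x) (bloch v R) e
        set β := ∑ e ∈ G.edgeFinset, w e * productValue (bloch v R) e
        have h1 := le_max_left α β
        have h2 := le_max_right α β
        linarith

end Rounding

end QMC

end

theorem theoremC {V : Type*} [Fintype V] [DecidableEq V] (G : SimpleGraph V)
    [DecidableRel G.Adj] (w : Sym2 V → ℝ) (hw : ∀ e ∈ G.edgeSet, 0 ≤ w e) :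
    (∃ x, QMC.IsOptimal G w x) ∧
    ∃ lam : ℝ, IsGreatest (spectrum ℝ (QMC.hamiltonian G w)) lam ∧
    ∀ x, QMC.IsOptimal G w x →
      lam ≤ QMC.relaxValue G w x ∧
      QMC.IsMatching (QMC.highEdges G 0.771 x) ∧
      (∃ v, QMC.IsGram (QMC.momentMatrix x) v) ∧
      ∀ v, QMC.IsGram (QMC.momentMatrix x) v →
        (∀ R, QMC.IsState (QMC.matchedState (QMC.highEdges G 0.771 x) (QMC.bloch v R)) ∧
          QMC.IsState (QMC.productState (QMC.bloch v R))) ∧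
        MeasureTheory.Integrable (QMC.algorithmValue G w 0.771 x v) (QMC.gaussianMatrix V) ∧
        0.526 * QMC.relaxValue G w x ≤
          ∫ R, QMC.algorithmValue G w 0.771 x v R ∂(QMC.gaussianMatrix V) ∧
        0.526 * lam ≤ ∫ R, QMC.algorithmValue G w 0.771 x v R ∂(QMC.gaussianMatrix V) := by
  refine ⟨QMC.exists_isOptimal G w, ?_⟩
  obtain ⟨lam, hlam⟩ := QMC.exists_isGreatest_spectrum G w
  refine ⟨lam, hlam, fun x hx => ?_⟩
  have hle := QMC.le_relaxValue_of_mem_spectrum G w hlam.1 hx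
  have hS : QMC.IsLooplessMatching (QMC.highEdges G 0.771 x) :=
    QMC.isLooplessMatching_highEdges G (by norm_num) hx.1
  refine ⟨hle, hS.matching, QMC.exists_isGram hx.1, fun v hv => ⟨fun R => ?_, ?_, ?_, ?_⟩⟩
  · have hθ := QMC.bloch_eq_zero_or_norm v R
    refine ⟨QMC.isState_matchedState hS hθ, ?_⟩
    rw [QMC.productState_eq]
    exact QMC.isState_matchedState QMC.isLooplessMatching_empty hθ
  · exact QMC.integrable_algorithmValue G w hx.1 v
  · exact QMC.ratio_le_integral_algorithmValue G w hw hx.1 hv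
  · exact (mul_le_mul_of_nonneg_left hle (by norm_num)).trans
      (QMC.ratio_le_integral_algorithmValue G w hw hx.1 hv)
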